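/- Let $(\mathcal M,\boldsymbol g)$ be a smooth 4-dimensional spacetime of signature $(+,-,-,-)$ with Levi-Civita spinor derivative $\nabla_{AA'}$; indices are moved by $\kappa^A=\epsilon^{AB}\kappa_B$, $\kappa_B=\kappa^A\epsilon_{AB}$, and likewise for primed indices. All fields are of class $C^1$ and live on an open set $U\subset\mathcal M$ that carries a smooth spin frame (every point has such a neighbourhood). Let $\tau^{AA'}$ be a Hermitian spinor field with $\tau_{AA'}\tau^{AA'}=2$, let $\varpi$ be a real function, and put $\zeta^{AA'}=\varpi^2\tau^{AA'}$, $$\widehat\kappa_{A_1\cdots A_k}=\tau_{A_1}{}^{A_1'}\cdots\tau_{A_k}{}^{A_k'}\,\bar\kappa_{A_1'\cdots A_k'},\qquad \nabla_{AB}=\tau_B{}^{A'}\nabla_{AA'},\qquad \chi_{ABCD}=\tfrac1{\sqrt2}\,\tau_D{}^{C'}\nabla_{AB}\tau_{CC'} .$$ Let $m\ge 2$, let $\mathfrak c$ be a real constant, and let $\phi_{A_1\cdots A_m}$, $\psi_{A_3\cdots A_m}$ be totally symmetric spinor fields of valence $m$ and $m-2$. Define $$\mathcal E_{A_1\cdots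 A_m}=\zeta_{(A_1}{}^{A'}\nabla^Q{}_{|A'|}\phi_{A_2\cdots A_m)Q}+\mathfrak c\,\zeta_{(A_1}{}^{A'}\nabla_{A_2|A'|}\psi_{A_3\cdots A_m)},$$ $$\mathcal F_{A_3\cdots A_m}=\zeta^{QA'}\nabla^P{}_{A'}\phi_{PQA_3\cdots A_m}+\mathfrak c\,\zeta^{PA'}\nabla_{(P|A'|}\psi_{A_3\cdots A_m)},$$ $$\mathbf E=\widehat\phi^{A_1\cdots A_m}\mathcal E_{A_1\cdots A_m}+(-1)^m\phi^{A_1\cdots A_m}\widehat{\mathcal E}_{A_1\cdots A_m},\qquad \mathbf F=\widehat\psi^{A_3\cdots A_m}\mathcal F_{A_3\cdots A_m}+(-1)^m\psi^{A_3\cdots A_m}\widehat{\mathcal F}_{A_3\cdots A_m}.$$ Lemma. On $U$, $$\begin{aligned}\mathbf E-\mathfrak c\,\mathbf F={}&\nabla^Q{}_{Q'}\big(\widehat\phi^{A_1\cdots A_m}\zeta_{A_1}{}^{Q'}\phi_{A_2\cdots A_mQ}\big)-\mathfrak c^2\,\nabla_{PP'}\big(\widehat\psi^{(A_3\cdots A_m}\zeta^{P)P'}\psi_{A_3\cdots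 A_m}\big)\\&+\mathfrak c\,\nabla_{QQ'}\big(\widehat\phi^{PQA_3\cdots A_m}\zeta_P{}^{Q'}\psi_{A_3\cdots A_m}\big)-\mathfrak c\,\nabla^P{}_{P'}\big(\widehat\psi^{A_3\cdots A_m}\zeta^{QP'}\phi_{PQA_3\cdots A_m}\big)\\&+\phi^{P_1\cdots P_m}W_{P_1\cdots P_m}{}^{Q_1\cdots Q_m}\widehat\phi_{Q_1\cdots Q_m}+\mathfrak c\,\phi^{P_1\cdots P_m}X_{P_1\cdots P_m}{}^{Q_3\cdots Q_m}\widehat\psi_{Q_3\cdots Q_m}\\&+\mathfrak c\,\psi^{P_3\cdots P_m}Y_{P_3\cdots P_m}{}^{Q_1\cdots Q_m}\widehat\phi_{Q_1\cdots Q_m}+\mathfrak c^2\,\psi^{P_3\cdots P_m}Z_{P_3\cdots P_m}{}^{Q_3\cdots Q_m}\widehat\psi_{Q_3\cdots Q_m},\end{aligned}$$ where $W,X,Y,Z$ are totally symmetric in each of their two groups of indices and depend solely on $\chi_{ABCD}$ and $\varpi$: for each $m$ their components at a point are fixed functions (the same for every spacetime, spin frame, $\tau$, $\varpi$, $\mathfrak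 c$, $\phi$, $\psi$ and point) of the values there of $\chi_{ABCD}$, $\varpi$ and $\nabla_{AB}\varpi$. In particular, the principal part of $\mathbf E-\mathfrak c\mathbf F$ is a total divergence. -/

import Mathlib

open scoped Manifold ContDiff Bundle

universe u

noncomputable section

namespace SpaceSpinor

/-! ### Spacetime and spin frames -/

/-- The model space of a 4-dimensional manifold. -/
abbrev E4 := EuclideanSpace ℝ (Fin 4)

/-- The Minkowski matrix `diag(1, -1, -1, -1)`. -/
def eta (a b : Fin 4) : ℝ := if a = b then (if a = 0 then 1 else -1) else 0

/-- A smooth Lorentzian metric of signature `(+,-,-,-)` on a smooth 4-manifold. -/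
structure LorentzMetric (M : Type*) [TopologicalSpace M] [ChartedSpace E4 M]
    [IsManifold 𝓘(ℝ, E4) ∞ M] where
  val : ∀ x : M, TangentSpace 𝓘(ℝ, E4) x →L[ℝ] TangentSpace 𝓘(ℝ, E4) x →L[ℝ] ℝ
  symm : ∀ x v w, val x v w = val x w v
  signature : ∀ x : M, ∃ b : Module.Basis (Fin 4) ℝ (TangentSpace 𝓘(ℝ, E4) x),
    ∀ i j, val x (b i) (b j) = eta i j
  contMDiff : ContMDiff 𝓘(ℝ, E4) (𝓘(ℝ, E4).prod 𝓘(ℝ, E4 →L[ℝ] E4 →L[ℝ] ℝ)) ∞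
    (fun x => Bundle.TotalSpace.mk' (E4 →L[ℝ] E4 →L[ℝ] ℝ)
      (E := fun x : M => TangentSpace 𝓘(ℝ, E4) x →L[ℝ] TangentSpace 𝓘(ℝ, E4) x →L[ℝ] ℝ)
      x (val x))

variable {M : Type*} [TopologicalSpace M] [ChartedSpace E4 M] [IsManifold 𝓘(ℝ, E4) ∞ M]

/-- A smooth spin frame on `U`, given by its associated smooth orthonormal tetrad. The spinor
bundle over `U` is trivialised by the frame, and the frame vectors are
`e_{AA'} = ∑ a, sigma a A A' • vec a`. -/
structure SpinFrame (g : LorentzMetric M) (U : Set M) where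
  vec : Fin 4 → ∀ x : M, TangentSpace 𝓘(ℝ, E4) x
  contMDiffOn : ∀ a, ContMDiffOn 𝓘(ℝ, E4) 𝓘(ℝ, E4).tangent ∞
    (fun x => (⟨x, vec a x⟩ : TangentBundle 𝓘(ℝ, E4) M)) U
  orthonormal : ∀ x ∈ U, ∀ a b, g.val x (vec a x) (vec b x) = eta a b

/-- The Infeld-van der Waerden symbols `σ^a_{AA'}` (Pauli matrices over `√2`), for which
`η_{ab} σ^a_{AA'} σ^b_{BB'} = ε_{AB} ε_{A'B'}`. -/
def sigma (a : Fin 4) (A A' : Fin 2) : ℂ :=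
  ((![!![1, 0; 0, 1], !![0, 1; 1, 0], !![0, -Complex.I; Complex.I, 0], !![1, 0; 0, -1]] :
    Fin 4 → Matrix (Fin 2) (Fin 2) ℂ) a A A') / (Real.sqrt 2 : ℂ)

/-- The components of the spinor metric; numerically `ε_{AB} = ε^{AB} = ε_{A'B'} = ε^{A'B'}`.
Indices move by `κ^A = ε^{AB} κ_B`, `κ_B = κ^A ε_{AB}`. -/
def eps (A B : Fin 2) : ℂ := (!![0, 1; -1, 0] : Matrix (Fin 2) (Fin 2) ℂ) A B

section Connection

variable {g : LorentzMetric M} {U : Set M} (e : SpinFrame g U)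

/-- The directional derivative of a complex function along a tangent vector. -/
def dirDeriv (f : M → ℂ) (x : M) (v : TangentSpace 𝓘(ℝ, E4) x) : ℂ :=
  mfderiv 𝓘(ℝ, E4) 𝓘(ℝ, ℂ) f x v

/-- The derivative `e_{AA'} f` of a complex function along the frame vectors. -/
def frameDeriv (f : M → ℂ) (x : M) (A A' : Fin 2) : ℂ :=
  ∑ a, sigma a A A' * dirDeriv f x (e.vec a x)

/-- `g([e_a, e_b], e_c)`. -/
def bracketCoeff (x : M) (a b c : Fin 4) : ℝ :=
  g.val x (VectorField.mlieBracket 𝓘(ℝ, E4) (e.vec a) (e.vec b) x) (e.vec c x)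

/-- The Levi-Civita connection in the tetrad, `g(∇_{e_a} e_b, e_c)`, by the Koszul formula. -/
def leviCivita (x : M) (a b c : Fin 4) : ℝ :=
  (bracketCoeff e x a b c - bracketCoeff e x b c a + bracketCoeff e x c a b) / 2

/-- `γ_{AA' BB' CC'} = g(∇_{AA'} e_{BB'}, e_{CC'})`. -/
def leviCivitaSpinor (x : M) (A A' B B' C C' : Fin 2) : ℂ :=
  ∑ a, ∑ b, ∑ c, sigma a A A' * sigma b B B' * sigma c C C' * (leviCivita e x a b c : ℂ)

/-- The spin connection coefficients `Γ_{AA'}{}^D{}_B = ½ ε^{DC} ε^{B'C'} γ_{AA' BB' CC'}`; they are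
characterised by `γ_{AA' BB' CC'} = Γ_{AA' CB} ε_{B'C'} + Γ̄_{AA' C'B'} ε_{BC}`
with `Γ_{AA' CB} = Γ_{AA'}{}^D{}_B ε_{DC}` symmetric in `CB`. -/
def spinConn (x : M) (A A' D B : Fin 2) : ℂ :=
  (∑ C, ∑ B', ∑ C', eps D C * eps B' C' * leviCivitaSpinor e x A A' B B' C C') / 2

/-- The coefficients `Γ̄_{AA'}{}^{D'}{}_{B'}` acting on primed indices (the complex conjugates). -/
def spinConnBar (x : M) (A A' D' B' : Fin 2) : ℂ :=
  (starRingEnd ℂ) (spinConn e x A' A D' B')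

end Connection

/-! ### Spinor fields, represented by their components in the spin frame -/

/-- Multi-indices `A_1 ⋯ A_k`. -/
abbrev Idx (k : ℕ) := Fin k → Fin 2

/-- Component arrays `κ_{A_1 ⋯ A_k}` of covariant valence `k` spinors. -/
abbrev Spinor (k : ℕ) := Idx k → ℂ

/-- Component arrays with one unprimed and one primed index. -/
abbrev Vec := Fin 2 → Fin 2 → ℂ

/-- `Q A_1 ⋯ A_k`. -/
abbrev cons {k : ℕ} (Q : Fin 2) (A : Idx k) : Idx (k + 1) := Fin.cons Q A

/-- `A_2 ⋯ A_k`. -/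
abbrev tail {k : ℕ} (A : Idx (k + 1)) : Idx k := Fin.tail A

/-- Total symmetry. -/
def IsSymm {k : ℕ} (κ : Spinor k) : Prop := ∀ (s : Equiv.Perm (Fin k)) (A : Idx k), κ (A ∘ s) = κ A

/-- Total symmetrisation `κ_{(A_1 ⋯ A_k)}`. -/
def symz {k : ℕ} (κ : Spinor k) : Spinor k :=
  fun A => (∑ s : Equiv.Perm (Fin k), κ (A ∘ s)) / (k.factorial : ℂ)

/-- `κ^{A_1 ⋯ A_k}`. -/
def raise {k : ℕ} (κ : Spinor k) : Spinor k := fun A => ∑ B : Idx k, (∏ i, eps (A i) (B i)) * κ B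

/-- The contraction `κ^{A_1 ⋯ A_k} μ_{A_1 ⋯ A_k}`. -/
def contr {k : ℕ} (κ μ : Spinor k) : ℂ := ∑ A : Idx k, raise κ A * μ A

/-- From `ξ^{AA'}` to `ξ_A{}^{A'}`. -/
def lowerFst (ξ : Vec) : Vec := fun A A' => ∑ B, ξ B A' * eps B A

/-- From `ξ^{AA'}` to `ξ_{AA'}`. -/
def lower (ξ : Vec) : Vec := fun A A' => ∑ B, ∑ B', ξ B B' * eps B A * eps B' A'

/-- Hermitian conjugation
`κ̂_{A_1 ⋯ A_k} = τ_{A_1}{}^{A'_1} ⋯ τ_{A_k}{}^{A'_k} κ̄_{A'_1 ⋯ A'_k}`; the argument is `τ^{AA'}`. -/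
def hat {k : ℕ} (τ : Vec) (κ : Spinor k) : Spinor k :=
  fun A => ∑ B : Idx k, (∏ i, lowerFst τ (A i) (B i)) * (starRingEnd ℂ) (κ B)

/-- `τ^{AA'}` is a `C¹` Hermitian spinor field on `U` with `τ_{AA'} τ^{AA'} = 2`. -/
structure IsTimelikeUnit (U : Set M) (τ : M → Vec) : Prop where
  hermitian : ∀ x ∈ U, ∀ A A', (starRingEnd ℂ) (τ x A A') = τ x A' A
  normalised : ∀ x ∈ U, ∑ A, ∑ A', lower (τ x) A A' * τ x A A' = 2
  contMDiffOn : ∀ A A', ContMDiffOn 𝓘(ℝ, E4) 𝓘(ℝ, ℂ) 1 (fun x => τ x A A') U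

/-- A `C¹` field on `U` of totally symmetric valence `k` spinors. -/
structure IsSymmField {k : ℕ} (U : Set M) (κ : M → Spinor k) : Prop where
  symm : ∀ x ∈ U, IsSymm (κ x)
  contMDiffOn : ∀ A, ContMDiffOn 𝓘(ℝ, E4) 𝓘(ℝ, ℂ) 1 (fun x => κ x A) U

section Fields

variable {g : LorentzMetric M} {U : Set M} (e : SpinFrame g U)

/-- `∇_{CC'} κ_{A_1 ⋯ A_k}`. -/
def nabla {k : ℕ} (κ : M → Spinor k) (x : M) (C C' : Fin 2) : Spinor k := fun A =>
  frameDeriv e (fun y => κ y A) x C C'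
    - ∑ i, ∑ B, spinConn e x C C' B (A i) * κ x (Function.update A i B)

/-- `∇^Q{}_{C'} κ_{A_1 ⋯ A_k}`. -/
def nablaUp {k : ℕ} (κ : M → Spinor k) (x : M) (Q C' : Fin 2) : Spinor k := fun A =>
  ∑ C, eps Q C * nabla e κ x C C' A

/-- `∇_{CC'} V^{BB'}`. -/
def nablaVec (V : M → Vec) (x : M) (C C' B B' : Fin 2) : ℂ :=
  frameDeriv e (fun y => V y B B') x C C'
    + ∑ D, spinConn e x C C' B D * V x D B' + ∑ D', spinConnBar e x C C' B' D' * V x B D'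

/-- The divergence `∇_{AA'} V^{AA'}`. -/
def div (V : M → Vec) (x : M) : ℂ := ∑ A, ∑ A', nablaVec e V x A A' A A'

/-- The Weingarten spinor in space-spinor form,
`χ_{ABCD} = (1/√2) τ_B{}^{A'} τ_D{}^{C'} ∇_{AA'} τ_{CC'}`. -/
def weingarten (τ : M → Vec) (x : M) (A B C D : Fin 2) : ℂ :=
  (∑ A', ∑ C', lowerFst (τ x) B A' * lowerFst (τ x) D C'
    * lower (fun F F' => nablaVec e τ x A A' F F') C C') / (Real.sqrt 2 : ℂ)

/-- The space-spinor derivative of the weight, `∇_{AB} ϖ = τ_B{}^{A'} ∇_{AA'} ϖ`. -/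
def spaceGrad (τ : M → Vec) (ϖ : M → ℝ) (x : M) (A B : Fin 2) : ℂ :=
  ∑ A', lowerFst (τ x) B A' * frameDeriv e (fun y => (ϖ y : ℂ)) x A A'

/-- The multiplier `ζ^{AA'} = ϖ² τ^{AA'}`. -/
def zeta (τ : M → Vec) (ϖ : M → ℝ) (x : M) : Vec := fun A A' => (ϖ x : ℂ) ^ 2 * τ x A A'

/-! ### The `φ`-`ψ` system; the valence of `φ` is `m = n + 2`, that of `ψ` is `m - 2 = n` -/

variable {n : ℕ} (τ : M → Vec) (ϖ : M → ℝ) (c : ℝ) (φ : M → Spinor (n + 2)) (ψ : M → Spinor n)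

/-- `𝓔_{A_1 ⋯ A_m} = ζ_{(A_1}{}^{A'} ∇^Q{}_{|A'|} φ_{A_2 ⋯ A_m)Q}
  + c ζ_{(A_1}{}^{A'} ∇_{A_2|A'|} ψ_{A_3 ⋯ A_m)}`. -/
def calE (x : M) : Spinor (n + 2) := symz fun A =>
  (∑ A', ∑ Q, lowerFst (zeta τ ϖ x) (A 0) A' * nablaUp e φ x Q A' (cons Q (tail A)))
    + c * ∑ A', lowerFst (zeta τ ϖ x) (A 0) A' * nabla e ψ x (A 1) A' (tail (tail A))

/-- `𝓕_{A_3 ⋯ A_m} = ζ^{QA'} ∇^P{}_{A'} φ_{PQA_3 ⋯ A_m}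
  + c ζ^{PA'} ∇_{(P|A'|} ψ_{A_3 ⋯ A_m)}`. -/
def calF (x : M) : Spinor n := fun A =>
  (∑ Q, ∑ P, ∑ A', zeta τ ϖ x Q A' * nablaUp e φ x P A' (cons P (cons Q A)))
    + c * ∑ P, ∑ A', zeta τ ϖ x P A'
      * symz (fun B : Idx (n + 1) => nabla e ψ x (B 0) A' (tail B)) (cons P A)

/-- `𝐄(φ,ψ) = φ̂^{A_1 ⋯ A_m} 𝓔_{A_1 ⋯ A_m} + (-1)^m φ^{A_1 ⋯ A_m} 𝓔̂_{A_1 ⋯ A_m}`. -/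
def formE (x : M) : ℂ :=
  contr (hat (τ x) (φ x)) (calE e τ ϖ c φ ψ x)
    + (-1) ^ (n + 2) * contr (φ x) (hat (τ x) (calE e τ ϖ c φ ψ x))

/-- `𝐅(φ,ψ) = ψ̂^{A_3 ⋯ A_m} 𝓕_{A_3 ⋯ A_m} + (-1)^m ψ^{A_3 ⋯ A_m} 𝓕̂_{A_3 ⋯ A_m}`. -/
def formF (x : M) : ℂ :=
  contr (hat (τ x) (ψ x)) (calF e τ ϖ c φ ψ x)
    + (-1) ^ (n + 2) * contr (ψ x) (hat (τ x) (calF e τ ϖ c φ ψ x))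

end Fields

section Currents

variable {n : ℕ} (τ : M → Vec) (ϖ : M → ℝ) (φ : M → Spinor (n + 2)) (ψ : M → Spinor n)

/-- `J^{QQ'} = φ̂^{A_1 ⋯ A_m} ζ_{A_1}{}^{Q'} φ_{A_2 ⋯ A_m}{}^Q`, so that
`∇^Q{}_{Q'} (φ̂^{A_1 ⋯ A_m} ζ_{A_1}{}^{Q'} φ_{A_2 ⋯ A_m Q}) = -∇_{QQ'} J^{QQ'}`. -/
def currentJ (x : M) : Vec := fun Q Q' =>
  ∑ A : Idx (n + 2), ∑ B, raise (hat (τ x) (φ x)) A * lowerFst (zeta τ ϖ x) (A 0) Q'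
    * eps Q B * φ x (cons B (tail A))

/-- `I^{PP'} = ψ̂^{(A_3 ⋯ A_m} ζ^{P)P'} ψ_{A_3 ⋯ A_m}`. -/
def currentI (x : M) : Vec := fun P P' =>
  ∑ A : Idx n,
    symz (fun B : Idx (n + 1) => zeta τ ϖ x (B 0) P' * raise (hat (τ x) (ψ x)) (tail B)) (cons P A)
      * ψ x A

/-- `K^{QQ'} = φ̂^{PQA_3 ⋯ A_m} ζ_P{}^{Q'} ψ_{A_3 ⋯ A_m}`. -/
def currentK (x : M) : Vec := fun Q Q' =>
  ∑ A : Idx n, ∑ P, raise (hat (τ x) (φ x)) (cons P (cons Q A)) * lowerFst (zeta τ ϖ x) P Q'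
    * ψ x A

/-- `L^{PP'} = ψ̂^{A_3 ⋯ A_m} ζ^{QP'} φ^P{}_{QA_3 ⋯ A_m}`, so that
`∇^P{}_{P'} (ψ̂^{A_3 ⋯ A_m} ζ^{QP'} φ_{PQA_3 ⋯ A_m}) = -∇_{PP'} L^{PP'}`. -/
def currentL (x : M) : Vec := fun P P' =>
  ∑ A : Idx n, ∑ Q, ∑ B, raise (hat (τ x) (ψ x)) A * zeta τ ϖ x Q P'
    * eps P B * φ x (cons B (cons Q A))

end Currents

/-- A rule that builds a coefficient spinor `T_{P_1 ⋯ P_k}{}^{Q_1 ⋯ Q_l}` at a point from the values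
there of `χ_{ABCD}`, `ϖ` and `∇_{AB} ϖ` (in this order), the same for every spacetime, spin frame and
point. -/
abbrev CoeffRule (k l : ℕ) :=
  (Fin 2 → Fin 2 → Fin 2 → Fin 2 → ℂ) → ℝ → (Fin 2 → Fin 2 → ℂ) → Idx k → Idx l → ℂ

/-- The coefficient spinor is totally symmetric in each of its two groups of indices. -/
def IsSymmRule {k l : ℕ} (T : CoeffRule k l) : Prop :=
  ∀ χ r d (s : Equiv.Perm (Fin k)) (t : Equiv.Perm (Fin l)) (P : Idx k) (Q : Idx l),
    T χ r d (P ∘ s) (Q ∘ t) = T χ r d P Q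

/-- The zeroth-order term `κ^{P_1 ⋯ P_k} T_{P_1 ⋯ P_k}{}^{Q_1 ⋯ Q_l} μ_{Q_1 ⋯ Q_l}`. -/
def quad {k l : ℕ} (κ : Spinor k) (T : Idx k → Idx l → ℂ) (μ : Spinor l) : ℂ :=
  ∑ P : Idx k, ∑ Q : Idx l, raise κ P * T P Q * μ Q

end SpaceSpinor

end

/-!
The identity is a Leibniz rule, and everything happens at one point.

*Currents as pairings.* Up to sign each of the four currents has the form
`ϖ² τ^{DQ'} ε^{QB} b_{DB}(û, v)`, where `u, v ∈ {φ, ψ}` and `b_{DB}` is one of four bilinear,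
`sl(2, ℂ)`-equivariant pairings of spinors (`pairingJ`, `pairingK`, `pairingL`, `pairingI`).
Equivariance is what makes the spin connection drop out of derivatives of `b_{DB}`, because the spin
connection is trace-free (`spinConn_trace`).

*Divergence.* `Pairing.IsEquivariant.div_current` computes the divergence of such a current. It is
the sum of a term with `∇v`, a term with the Hermitian conjugate of `∇u`, and a bilinear form in `û`
and `v`. The last one collects `∇(ϖ² τ)` and the failure of `∇` to commute with Hermitian
conjugation (`HasNabla.hat`). In it the primed indices can be moved to unprimed ones by `τ`, so that
only `χ_{ABCD}`, `ϖ` and `∇_{AB} ϖ` enter (`Pairing.zeroForm`).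

*Principal parts.* The pairing `κ, μ ↦ κ̂^{A_1 ⋯ A_k} μ_{A_1 ⋯ A_k}` is Hermitian
(`conj_contr_hat`), so that `𝐄` and `𝐅` are twice the real parts of `φ̂ · 𝓔` and `ψ̂ · 𝓕`. By
`contr_calE` and `contr_calF` these contractions are the `∇v` halves of the divergences, and complex
conjugation turns the `∇v` half for `J`, `I`, `K`, `L` into the `∇u` half for `J`, `I`, `L`, `K`
(`Pairing.IsConjugate`). Hence `𝐄 - c 𝐅` and the divergences differ by the forms `zeroForm` alone,
and symmetrising the coefficients of these forms gives `W`, `X`, `Y`, `Z` (`exists_symm_rule`).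
-/

noncomputable section

namespace SpaceSpinor

/-! ### Multilinear algebra of spinors -/

/-- The components `κ_{D A_1 ⋯ A_k}` with the first index fixed to `D`. -/
def slice {k : ℕ} (D : Fin 2) (κ : Spinor (k + 1)) : Spinor k := fun A => κ (cons D A)

/-- The derivation extension of a matrix to `k` lower indices:
`κ_{A_1 ⋯ A_k} ↦ ∑ i, M_{A_i}{}^D κ_{A_1 ⋯ D ⋯ A_k}`. -/
def act {k : ℕ} (M : Fin 2 → Fin 2 → ℂ) (κ : Spinor k) : Spinor k := fun A =>
  ∑ i, ∑ D, M (A i) D * κ (Function.update A i D)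

theorem slice_apply {k : ℕ} (D : Fin 2) (κ : Spinor (k + 1)) (A : Idx k) :
    slice D κ A = κ (cons D A) := rfl

theorem sum_idx_succ {k : ℕ} {R : Type*} [AddCommMonoid R] (f : Idx (k + 1) → R) :
    ∑ A, f A = ∑ D, ∑ A : Idx k, f (cons D A) := by
  rw [← (Fin.consEquiv (fun _ : Fin (k + 1) => Fin 2)).sum_comp, Fintype.sum_prod_type]
  rfl

@[simp] theorem slice_add {k : ℕ} (D : Fin 2) (κ μ : Spinor (k + 1)) :
    slice D (κ + μ) = slice D κ + slice D μ := rfl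

@[simp] theorem slice_smul {k : ℕ} (D : Fin 2) (c : ℂ) (κ : Spinor (k + 1)) :
    slice D (c • κ) = c • slice D κ := rfl

theorem raise_zero (κ : Spinor 0) (A : Idx 0) : raise κ A = κ A := by
  simp only [raise, Fintype.sum_unique, Finset.univ_eq_empty, Finset.prod_empty, one_mul]
  exact congrArg κ (Subsingleton.elim _ _)

theorem raise_cons {k : ℕ} (κ : Spinor (k + 1)) (D : Fin 2) (A : Idx k) :
    raise κ (cons D A) = ∑ B, eps D B * raise (slice B κ) A := by
  simp only [raise, sum_idx_succ (k := k), Fin.prod_univ_succ, Fin.cons_zero, Fin.cons_succ,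
    slice, Finset.mul_sum, mul_assoc]

theorem hat_zero (τ : Vec) (κ : Spinor 0) (A : Idx 0) : hat τ κ A = (starRingEnd ℂ) (κ A) := by
  simp only [hat, Fintype.sum_unique, Finset.univ_eq_empty, Finset.prod_empty, one_mul]
  exact congrArg _ (congrArg κ (Subsingleton.elim _ _))

theorem slice_hat {k : ℕ} (τ : Vec) (κ : Spinor (k + 1)) (D : Fin 2) :
    slice D (hat τ κ) = ∑ B, lowerFst τ D B • hat τ (slice B κ) := by
  funext A
  simp only [hat, sum_idx_succ (k := k), Fin.prod_univ_succ, Fin.cons_zero, Fin.cons_succ,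
    slice, Finset.mul_sum, mul_assoc, Finset.sum_apply, Pi.smul_apply, smul_eq_mul]

theorem hat_add {k : ℕ} (τ : Vec) (κ μ : Spinor k) : hat τ (κ + μ) = hat τ κ + hat τ μ := by
  funext A
  simp [hat, mul_add, Finset.sum_add_distrib]

theorem hat_smul {k : ℕ} (τ : Vec) (c : ℂ) (κ : Spinor k) :
    hat τ (c • κ) = (starRingEnd ℂ) c • hat τ κ := by
  funext A
  simp [hat, Finset.mul_sum, mul_left_comm]

theorem contr_zero (κ μ : Spinor 0) (A : Idx 0) : contr κ μ = κ A * μ A := by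
  rw [contr, Fintype.sum_unique, raise_zero]
  exact congrArg (fun B => κ B * μ B) (Subsingleton.elim _ _)

theorem contr_succ {k : ℕ} (κ μ : Spinor (k + 1)) :
    contr κ μ = ∑ D, ∑ B, eps D B * contr (slice B κ) (slice D μ) := by
  simp only [contr, sum_idx_succ (k := k), raise_cons, Finset.mul_sum, Finset.sum_mul]
  refine Finset.sum_congr rfl fun D _ => ?_
  rw [Finset.sum_comm]
  simp only [mul_assoc]
  rfl

/-- Contraction of spinors as a bilinear map. -/
def contrL (k : ℕ) : Spinor k →ₗ[ℂ] Spinor k →ₗ[ℂ] ℂ :=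
  LinearMap.mk₂ ℂ contr
    (fun κ κ' μ => by simp [contr, raise, mul_add, add_mul, Finset.sum_add_distrib])
    (fun c κ μ => by
      simp [contr, raise, Finset.mul_sum, Finset.sum_mul, mul_assoc, mul_left_comm])
    (fun κ μ μ' => by simp [contr, mul_add, Finset.sum_add_distrib])
    (fun c κ μ => by simp [contr, Finset.mul_sum, mul_left_comm])

theorem contrL_apply {k : ℕ} (κ μ : Spinor k) : contrL k κ μ = contr κ μ := rfl

/-- `slice D` as a linear map. -/
def sliceL (k : ℕ) (D : Fin 2) : Spinor (k + 1) →ₗ[ℂ] Spinor k where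
  toFun := slice D
  map_add' _ _ := rfl
  map_smul' _ _ := rfl

/-- `act M` as a linear map. -/
def actL (k : ℕ) (M : Fin 2 → Fin 2 → ℂ) : Spinor k →ₗ[ℂ] Spinor k where
  toFun := act M
  map_add' κ μ := by funext A; simp [act, mul_add, Finset.sum_add_distrib]
  map_smul' c κ := by
    funext A
    simp only [act, Finset.mul_sum, mul_left_comm, Pi.smul_apply, smul_eq_mul, RingHom.id_apply]

theorem actL_apply {k : ℕ} (M : Fin 2 → Fin 2 → ℂ) (κ : Spinor k) : actL k M κ = act M κ := rfl

theorem act_add {k : ℕ} (M : Fin 2 → Fin 2 → ℂ) (κ μ : Spinor k) :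
    act M (κ + μ) = act M κ + act M μ := (actL k M).map_add κ μ

theorem act_smul {k : ℕ} (M : Fin 2 → Fin 2 → ℂ) (c : ℂ) (κ : Spinor k) :
    act M (c • κ) = c • act M κ := (actL k M).map_smul c κ

theorem act_zero (M : Fin 2 → Fin 2 → ℂ) (κ : Spinor 0) : act M κ = 0 := by
  funext A; simp [act]

theorem slice_act {k : ℕ} (M : Fin 2 → Fin 2 → ℂ) (κ : Spinor (k + 1)) (D : Fin 2) :
    slice D (act M κ) = act M (slice D κ) + ∑ E, M D E • slice E κ := by
  funext A
  simp only [slice, act, Fin.sum_univ_succ (n := k), Fin.cons_zero, Fin.cons_succ,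
    Fin.update_cons_zero, ← Fin.cons_update, Pi.add_apply, Finset.sum_apply, Pi.smul_apply,
    smul_eq_mul]
  rw [add_comm]

theorem act_add_left {k : ℕ} (M N : Fin 2 → Fin 2 → ℂ) (κ : Spinor k) :
    act (M + N) κ = act M κ + act N κ := by
  funext A; simp only [act, Pi.add_apply, add_mul, Finset.sum_add_distrib]

theorem act_smul_left {k : ℕ} (c : ℂ) (M : Fin 2 → Fin 2 → ℂ) (κ : Spinor k) :
    act (c • M) κ = c • act M κ := by
  funext A; simp only [act, Pi.smul_apply, smul_eq_mul, mul_assoc, Finset.mul_sum]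

/-- The contraction is invariant under `sl(2, ℂ)`. -/
theorem contr_act {k : ℕ} (M : Fin 2 → Fin 2 → ℂ) (hM : M 0 0 + M 1 1 = 0) (κ μ : Spinor k) :
    contr (act M κ) μ + contr κ (act M μ) = 0 := by
  induction k with
  | zero => simp only [act_zero, ← contrL_apply]; simp
  | succ k ih =>
    have h : M 1 1 = - M 0 0 := by linear_combination hM
    have key := fun B D => ih (slice B κ) (slice D μ)
    simp only [← contrL_apply] at key
    simp only [contr_succ, slice_act, ← contrL_apply, Fin.sum_univ_two, map_add, map_smul,
      LinearMap.add_apply, LinearMap.smul_apply, smul_eq_mul, eps, h]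
    simp
    linear_combination key 1 0 - key 0 1

theorem contr_hat_right {k : ℕ} (τ : Vec) (hτ : ∀ A A', (starRingEnd ℂ) (τ A A') = τ A' A)
    (κ μ : Spinor k) :
    contr κ (hat τ μ) = (-1) ^ k * (starRingEnd ℂ) (contr (hat τ κ) μ) := by
  induction k with
  | zero => simp [contr_zero _ _ ![], hat_zero]
  | succ k ih =>
    simp only [contr_succ, slice_hat, ← contrL_apply, Fin.sum_univ_two, map_add, map_smul,
      LinearMap.add_apply, LinearMap.smul_apply, smul_eq_mul, map_mul, lowerFst]
    simp only [contrL_apply, ih, hτ]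
    simp [eps, pow_succ]
    ring

theorem contr_comm {k : ℕ} (κ μ : Spinor k) : contr κ μ = (-1) ^ k * contr μ κ := by
  induction k with
  | zero => simp [contr_zero _ _ ![], mul_comm]
  | succ k ih =>
    simp only [contr_succ, Fin.sum_univ_two]
    simp only [ih (slice _ κ) (slice _ μ)]
    simp [eps, pow_succ]
    ring

/-- The pairing `κ, μ ↦ κ̂^{A_1 ⋯ A_k} μ_{A_1 ⋯ A_k}` is Hermitian. -/
theorem conj_contr_hat {k : ℕ} (τ : Vec) (hτ : ∀ A A', (starRingEnd ℂ) (τ A A') = τ A' A)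
    (κ μ : Spinor k) :
    (starRingEnd ℂ) (contr (hat τ κ) μ) = contr (hat τ μ) κ := by
  rw [contr_comm (hat τ μ) κ, contr_hat_right τ hτ, ← mul_assoc, ← mul_pow]
  simp

/-! ### Total symmetry -/

theorem sum_comp_perm {k : ℕ} {R : Type*} [AddCommMonoid R] (s : Equiv.Perm (Fin k))
    (f : Idx k → R) : ∑ A : Idx k, f (A ∘ s) = ∑ A, f A :=
  (Equiv.arrowCongr s.symm (Equiv.refl (Fin 2))).sum_comp f

theorem IsSymm.raise {k : ℕ} {κ : Spinor k} (h : IsSymm κ) : IsSymm (raise κ) := by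
  intro s A
  simp only [SpaceSpinor.raise]
  rw [← sum_comp_perm s]
  refine Finset.sum_congr rfl fun B _ => ?_
  rw [h s B]
  congr 1
  exact Equiv.prod_comp s (fun i => eps (A i) (B i))

theorem IsSymm.hat {k : ℕ} {κ : Spinor k} (h : IsSymm κ) (τ : Vec) : IsSymm (hat τ κ) := by
  intro s A
  simp only [SpaceSpinor.hat]
  rw [← sum_comp_perm s]
  refine Finset.sum_congr rfl fun B _ => ?_
  rw [h s B]
  congr 1
  exact Equiv.prod_comp s (fun i => lowerFst τ (A i) (B i))

theorem IsSymm.act {k : ℕ} {κ : Spinor k} (h : IsSymm κ) (M : Fin 2 → Fin 2 → ℂ) :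
    IsSymm (act M κ) := by
  intro s A
  simp only [SpaceSpinor.act]
  rw [← Equiv.sum_comp s fun i => ∑ D, M (A i) D * κ (Function.update A i D)]
  refine Finset.sum_congr rfl fun i _ => Finset.sum_congr rfl fun D _ => ?_
  rw [← Function.update_comp_eq_of_injective _ s.injective, h s, Function.comp_apply]

theorem IsSymm.contr_symz {k : ℕ} {κ : Spinor k} (h : IsSymm κ) (μ : Spinor k) :
    contr κ (symz μ) = contr κ μ := by
  have hf : (k.factorial : ℂ) ≠ 0 := by exact_mod_cast k.factorial_ne_zero
  have hs : ∀ s : Equiv.Perm (Fin k), ∑ A, SpaceSpinor.raise κ A * μ (A ∘ s) = contr κ μ := by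
    intro s
    rw [contr]
    conv_rhs => rw [← sum_comp_perm s]
    exact Finset.sum_congr rfl fun A _ => by rw [h.raise s A]
  simp only [contr, symz, ← mul_div_assoc, Finset.mul_sum]
  rw [← Finset.sum_div, Finset.sum_comm, Finset.sum_congr rfl fun s _ => hs s]
  simp only [Finset.sum_const, Finset.card_univ, Fintype.card_perm, Fintype.card_fin,
    nsmul_eq_mul, contr]
  field_simp

/-- Symmetrisation over `k + 1` indices of an array that is symmetric in the last `k` of them. -/
theorem symz_of_slice_symm {k : ℕ} (f : Spinor (k + 1)) (hf : ∀ D, IsSymm (slice D f))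
    (B : Fin 2) (A : Idx k) :
    symz f (cons B A)
      = (f (cons B A) + ∑ j, f (cons (A j) (Function.update A j B))) / (k + 1 : ℂ) := by
  have hs : ∀ p (s : Equiv.Perm (Fin k)), f (cons B A ∘ Equiv.Perm.decomposeFin.symm (p, s))
      = f (cons B A ∘ Equiv.swap 0 p) := by
    intro p s
    have := hf ((cons B A : Idx (k + 1)) p) s (tail ((cons B A : Idx (k + 1)) ∘ Equiv.swap 0 p))
    simp only [slice] at this
    convert this using 2
    · funext i
      refine Fin.cases ?_ (fun j => ?_) i <;> simp [Fin.tail]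
    · funext i
      refine Fin.cases ?_ (fun j => ?_) i <;> simp [Fin.tail]
  have hp : ∀ j : Fin k, f (cons B A ∘ Equiv.swap 0 j.succ)
      = f (cons (A j) (Function.update A j B)) := by
    intro j
    congr 1
    funext i
    refine Fin.cases ?_ (fun l => ?_) i
    · simp
    · by_cases hl : l = j
      · subst hl; simp
      · simp [hl, Equiv.swap_apply_of_ne_of_ne (Fin.succ_ne_zero l)
          (fun h => hl (Fin.succ_injective _ h))]
  have hk : (k.factorial : ℂ) ≠ 0 := by exact_mod_cast k.factorial_ne_zero
  have hk1 : (k + 1 : ℂ) ≠ 0 := by exact_mod_cast k.succ_ne_zero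
  simp only [symz]
  rw [← (Equiv.Perm.decomposeFin.symm).sum_comp, Fintype.sum_prod_type]
  simp only [hs, Finset.sum_const, Finset.card_univ, Fintype.card_perm, Fintype.card_fin,
    nsmul_eq_mul, ← Finset.mul_sum, Fin.sum_univ_succ, hp, Equiv.swap_self, Equiv.coe_refl,
    Function.comp_id, Nat.factorial_succ]
  push_cast
  field_simp

/-! ### Coefficient rules from bilinear forms -/

/-- `κ_{A_1 ⋯ A_k} = κ^{P_1 ⋯ P_k} ε_{P_1A_1} ⋯ ε_{P_kA_k}`. -/
theorem raise_basis {k : ℕ} (κ : Spinor k) :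
    κ = ∑ P : Idx k, raise κ P • fun A => ∏ i, eps (P i) (A i) := by
  have h2 : ∀ a b : Fin 2, ∑ p, eps p a * eps p b = if a = b then 1 else 0 := by
    intro a b
    fin_cases a <;> fin_cases b <;> simp [eps]
  have h : ∀ A B : Idx k, ∑ P : Idx k, (∏ i, eps (P i) (B i)) * ∏ i, eps (P i) (A i)
      = if B = A then 1 else 0 := by
    intro A B
    simp only [← Finset.prod_mul_distrib]
    rw [← Fintype.prod_sum (fun i p => eps p (B i) * eps p (A i))]
    simp only [h2, funext_iff]
    split_ifs with hAB
    · simp [hAB]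
    · push Not at hAB
      obtain ⟨i, hi⟩ := hAB
      exact Finset.prod_eq_zero (Finset.mem_univ i) (by simp [hi])
  funext A
  simp only [Finset.sum_apply, Pi.smul_apply, smul_eq_mul, raise, Finset.sum_mul]
  rw [Finset.sum_comm]
  have : ∀ B, ∑ P : Idx k, (∏ i, eps (P i) (B i)) * κ B * ∏ i, eps (P i) (A i)
      = (if B = A then 1 else 0) * κ B := by
    intro B
    rw [← h A B, Finset.sum_mul]
    exact Finset.sum_congr rfl fun P _ => by ring
  simp [this]

/-- On symmetric spinors, every family of bilinear forms comes from a symmetric coefficient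
rule. -/
theorem exists_symm_rule {k l : ℕ}
    (Φ : (Fin 2 → Fin 2 → Fin 2 → Fin 2 → ℂ) → ℝ → (Fin 2 → Fin 2 → ℂ) →
      Spinor l →ₗ[ℂ] Spinor k →ₗ[ℂ] ℂ) :
    ∃ T : CoeffRule k l, IsSymmRule T ∧ ∀ χ r d κ μ, IsSymm κ → IsSymm μ →
      quad κ (T χ r d) μ = Φ χ r d μ κ := by
  let N : CoeffRule k l := fun χ r d P Q =>
    Φ χ r d (Pi.single Q 1) (fun A => ∏ i, eps (P i) (A i))
  have hN : ∀ χ r d κ μ, quad κ (N χ r d) μ = Φ χ r d μ κ := by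
    intro χ r d κ μ
    have hμ : μ = ∑ Q, μ Q • (Pi.single Q 1 : Spinor l) := by
      funext A
      simp [Finset.sum_apply, Pi.single_apply]
    conv_rhs => rw [raise_basis κ, hμ]
    simp only [quad, N, map_sum, map_smul, LinearMap.sum_apply, LinearMap.smul_apply, smul_eq_mul,
      Finset.mul_sum]
    refine Finset.sum_congr rfl fun P _ => Finset.sum_congr rfl fun Q _ => ?_
    rw [mul_comm (μ Q), mul_assoc]
  refine ⟨fun χ r d P Q => (∑ s : Equiv.Perm (Fin k), ∑ t : Equiv.Perm (Fin l),
    N χ r d (P ∘ s) (Q ∘ t)) / (k.factorial * l.factorial : ℂ), ?_, ?_⟩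
  · intro χ r d s t P Q
    dsimp only
    congr 1
    exact (Finset.sum_congr rfl fun (s' : Equiv.Perm (Fin k)) _ => Equiv.sum_comp (Equiv.mulLeft t)
      fun t' : Equiv.Perm (Fin l) => N χ r d (P ∘ ⇑(s * s')) (Q ∘ t')).trans
      (Equiv.sum_comp (Equiv.mulLeft s)
        fun s' : Equiv.Perm (Fin k) => ∑ t' : Equiv.Perm (Fin l), N χ r d (P ∘ s') (Q ∘ t'))
  · intro χ r d κ μ hκ hμ
    have hk : (k.factorial : ℂ) ≠ 0 := by exact_mod_cast k.factorial_ne_zero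
    have hl : (l.factorial : ℂ) ≠ 0 := by exact_mod_cast l.factorial_ne_zero
    have hs : ∀ (s : Equiv.Perm (Fin k)) (t : Equiv.Perm (Fin l)),
        quad κ (fun P Q => N χ r d (P ∘ s) (Q ∘ t)) μ = Φ χ r d μ κ := by
      intro s t
      rw [← hN, quad, quad]
      conv_rhs => rw [← sum_comp_perm s]
      refine Finset.sum_congr rfl fun P _ => ?_
      conv_rhs => rw [← sum_comp_perm t (fun Q => raise κ (P ∘ s) * N χ r d (P ∘ s) Q * μ Q)]
      exact Finset.sum_congr rfl fun Q _ => by rw [hκ.raise s P, hμ t Q]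
    have : ∑ s : Equiv.Perm (Fin k), ∑ t : Equiv.Perm (Fin l),
        quad κ (fun P Q => N χ r d (P ∘ s) (Q ∘ t)) μ
        = (k.factorial * l.factorial : ℂ) * Φ χ r d μ κ := by
      simp only [hs, Finset.sum_const, Finset.card_univ, Fintype.card_perm, Fintype.card_fin,
        nsmul_eq_mul]
      ring
    rw [← mul_right_inj' (mul_ne_zero hk hl), ← this]
    have hq : ∀ P Q, (k.factorial * l.factorial : ℂ) * (raise κ P * ((∑ s : Equiv.Perm (Fin k),
        ∑ t : Equiv.Perm (Fin l), N χ r d (P ∘ s) (Q ∘ t)) / (k.factorial * l.factorial : ℂ)) * μ Q)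
        = ∑ s : Equiv.Perm (Fin k), ∑ t : Equiv.Perm (Fin l),
          raise κ P * N χ r d (P ∘ s) (Q ∘ t) * μ Q := by
      intro P Q
      simp only [← Finset.mul_sum, ← Finset.sum_mul]
      field_simp
    simp only [quad, Finset.mul_sum] at hq ⊢
    simp only [hq]
    rw [Finset.sum_congr rfl fun P (_ : P ∈ Finset.univ) => Finset.sum_comm, Finset.sum_comm]
    refine Finset.sum_congr rfl fun s _ => ?_
    rw [Finset.sum_congr rfl fun P (_ : P ∈ Finset.univ) => Finset.sum_comm, Finset.sum_comm]

/-! ### Frame derivatives at a point -/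

section Derivative

variable {M : Type*} [TopologicalSpace M] [ChartedSpace E4 M] [IsManifold 𝓘(ℝ, E4) ∞ M]
variable {g : LorentzMetric M} {U : Set M} (e : SpinFrame g U) (x : M)

/-- `f` is differentiable at `x`, with frame derivatives `e_{CC'} f = d_{CC'}`. -/
def HasFrameDeriv (f : M → ℂ) (d : Vec) : Prop :=
  MDifferentiableAt 𝓘(ℝ, E4) 𝓘(ℝ, ℂ) f x ∧ frameDeriv e f x = d

variable {e x}

theorem HasFrameDeriv.congr_deriv {f : M → ℂ} {d d' : Vec} (h : HasFrameDeriv e x f d)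
    (hd : ∀ C C', d C C' = d' C C') : HasFrameDeriv e x f d' :=
  ⟨h.1, h.2.trans (funext fun C => funext fun C' => hd C C')⟩

theorem frameDeriv_congr {f f' : M → ℂ} (hf : f' =ᶠ[nhds x] f) :
    frameDeriv e f' x = frameDeriv e f x := by
  funext C C'
  simp only [frameDeriv, dirDeriv, hf.mfderiv_eq]
  rfl

theorem HasFrameDeriv.congr {f f' : M → ℂ} {d : Vec} (h : HasFrameDeriv e x f d)
    (hf : f' =ᶠ[nhds x] f) : HasFrameDeriv e x f' d :=
  ⟨h.1.congr_of_eventuallyEq hf, (frameDeriv_congr hf).trans h.2⟩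

theorem _root_.MDifferentiableAt.hasFrameDeriv {f : M → ℂ}
    (h : MDifferentiableAt 𝓘(ℝ, E4) 𝓘(ℝ, ℂ) f x) : HasFrameDeriv e x f (frameDeriv e f x) :=
  ⟨h, rfl⟩

theorem HasFrameDeriv.const (c : ℂ) : HasFrameDeriv e x (fun _ => c) 0 := by
  refine ⟨mdifferentiableAt_const, ?_⟩
  funext C C'
  simp only [frameDeriv, dirDeriv, mfderiv_const]
  exact Finset.sum_eq_zero fun a _ => mul_zero _

theorem HasFrameDeriv.add {f f' : M → ℂ} {d d' : Vec} (h : HasFrameDeriv e x f d)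
    (h' : HasFrameDeriv e x f' d') : HasFrameDeriv e x (fun y => f y + f' y) (d + d') := by
  have := h.1.hasMFDerivAt.add h'.1.hasMFDerivAt
  refine ⟨this.mdifferentiableAt, ?_⟩
  rw [← h.2, ← h'.2]
  funext C C'
  simp only [frameDeriv, Pi.add_apply, ← Finset.sum_add_distrib, ← mul_add]
  refine Finset.sum_congr rfl fun a _ => congrArg _ ?_
  exact congrArg (fun L => L (e.vec a x)) this.mfderiv

theorem HasFrameDeriv.mul {f f' : M → ℂ} {d d' : Vec} (h : HasFrameDeriv e x f d)
    (h' : HasFrameDeriv e x f' d') :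
    HasFrameDeriv e x (fun y => f y * f' y) (f x • d' + f' x • d) := by
  have := h.1.hasMFDerivAt.mul h'.1.hasMFDerivAt
  refine ⟨this.mdifferentiableAt, ?_⟩
  rw [← h.2, ← h'.2]
  funext C C'
  simp only [frameDeriv, Pi.add_apply, Pi.smul_apply, smul_eq_mul, Finset.mul_sum,
    ← Finset.sum_add_distrib]
  refine Finset.sum_congr rfl fun a _ => ?_
  have h2 : dirDeriv (fun y => f y * f' y) x (e.vec a x)
      = f x * dirDeriv f' x (e.vec a x) + f' x * dirDeriv f x (e.vec a x) :=
    congrArg (fun L => L (e.vec a x)) this.mfderiv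
  rw [h2]
  ring

theorem conj_sigma (a : Fin 4) (A A' : Fin 2) : (starRingEnd ℂ) (sigma a A A') = sigma a A' A := by
  fin_cases a <;> fin_cases A <;> fin_cases A' <;> simp [sigma]

theorem HasFrameDeriv.conj {f : M → ℂ} {d : Vec} (h : HasFrameDeriv e x f d) :
    HasFrameDeriv e x (fun y => (starRingEnd ℂ) (f y))
      (fun C C' => (starRingEnd ℂ) (d C' C)) := by
  have := (Complex.conjCLE : ℂ →L[ℝ] ℂ).hasMFDerivAt.comp x h.1.hasMFDerivAt
  refine ⟨this.mdifferentiableAt, ?_⟩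
  rw [← h.2]
  funext C C'
  simp only [frameDeriv, map_sum, map_mul, conj_sigma]
  refine Finset.sum_congr rfl fun a _ => congrArg _ ?_
  exact congrArg (fun L => L (e.vec a x)) this.mfderiv

theorem HasFrameDeriv.sum {ι : Type*} (s : Finset ι) {f : ι → M → ℂ} {d : ι → Vec}
    (h : ∀ i ∈ s, HasFrameDeriv e x (f i) (d i)) :
    HasFrameDeriv e x (fun y => ∑ i ∈ s, f i y) (∑ i ∈ s, d i) := by
  classical
  induction s using Finset.induction_on with
  | empty => simpa using HasFrameDeriv.const (e := e) (x := x) 0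
  | insert i s hi ih =>
    simp only [Finset.sum_insert hi]
    exact (h i (Finset.mem_insert_self i s)).add
      (ih fun j hj => h j (Finset.mem_insert_of_mem hj))

theorem HasFrameDeriv.const_mul {f : M → ℂ} {d : Vec} (h : HasFrameDeriv e x f d) (c : ℂ) :
    HasFrameDeriv e x (fun y => c * f y) (c • d) :=
  ((HasFrameDeriv.const c).mul h).congr_deriv fun C C' => by simp

/-- The product rule for bilinear expressions in the components of two spinor fields. -/
theorem HasFrameDeriv.bilin {k l : ℕ} (b : Spinor k →ₗ[ℂ] Spinor l →ₗ[ℂ] ℂ)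
    {u : M → Spinor k} {v : M → Spinor l} {du : Fin 2 → Fin 2 → Spinor k}
    {dv : Fin 2 → Fin 2 → Spinor l}
    (hu : ∀ A, HasFrameDeriv e x (fun y => u y A) (fun C C' => du C C' A))
    (hv : ∀ A, HasFrameDeriv e x (fun y => v y A) (fun C C' => dv C C' A)) :
    HasFrameDeriv e x (fun y => b (u y) (v y))
      (fun C C' => b (du C C') (v x) + b (u x) (dv C C')) := by
  obtain ⟨c, hb⟩ : ∃ c : Idx k → Idx l → ℂ, ∀ (κ : Spinor k) (μ : Spinor l),
      b κ μ = ∑ A, ∑ B, c A B * (κ A * μ B) := by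
    refine ⟨fun A B => b (Pi.single A 1) (Pi.single B 1), fun κ μ => ?_⟩
    have hκ : κ = ∑ A, κ A • (Pi.single A 1 : Spinor k) := by
      funext A; simp [Finset.sum_apply, Pi.single_apply]
    have hμ : μ = ∑ A, μ A • (Pi.single A 1 : Spinor l) := by
      funext A; simp [Finset.sum_apply, Pi.single_apply]
    conv_lhs => rw [hκ, hμ]
    simp only [map_sum, map_smul, LinearMap.sum_apply, LinearMap.smul_apply, smul_eq_mul,
      Finset.mul_sum]
    rw [Finset.sum_comm]
    exact Finset.sum_congr rfl fun A _ => Finset.sum_congr rfl fun B _ => by ring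
  simp only [hb]
  refine (HasFrameDeriv.sum _ fun A _ => HasFrameDeriv.sum _ fun B _ =>
    ((hu A).mul (hv B)).const_mul _).congr_deriv fun C C' => ?_
  simp only [Finset.sum_apply, Pi.smul_apply, Pi.add_apply, smul_eq_mul,
    ← Finset.sum_add_distrib]
  exact Finset.sum_congr rfl fun A _ => Finset.sum_congr rfl fun B _ => by ring

/-! ### Covariant derivatives at a point -/

theorem leviCivita_antisymm (a b c : Fin 4) : leviCivita e x a c b = - leviCivita e x a b c := by
  have h : ∀ a b c, bracketCoeff e x b a c = - bracketCoeff e x a b c := by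
    intro a b c
    simp only [bracketCoeff]
    rw [VectorField.mlieBracket_swap_apply]
    simp
  simp only [leviCivita]
  rw [h b a c, h b c a, h c a b]
  ring

theorem leviCivitaSpinor_antisymm (A A' B B' C C' : Fin 2) :
    leviCivitaSpinor e x A A' C C' B B' = - leviCivitaSpinor e x A A' B B' C C' := by
  simp only [leviCivitaSpinor, ← Finset.sum_neg_distrib]
  refine Finset.sum_congr rfl fun a _ => ?_
  rw [Finset.sum_comm]
  refine Finset.sum_congr rfl fun b _ => Finset.sum_congr rfl fun c _ => ?_
  rw [leviCivita_antisymm a b c]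
  push_cast
  ring

/-- The spin connection takes values in `sl(2, ℂ)`, so that it annihilates `ε_{AB}`. -/
theorem spinConn_trace (C C' : Fin 2) : spinConn e x C C' 1 1 = - spinConn e x C C' 0 0 := by
  have h := leviCivitaSpinor_antisymm (e := e) (x := x) C C'
  have h1 := h 0 0 1 1
  have h2 := h 0 1 1 0
  simp only [spinConn, Fin.sum_univ_two, eps]
  simp
  linear_combination (h1 - h2) / 2

variable (e x)

/-- `κ` is differentiable at `x` and `∇_{CC'} κ = N_{CC'}` there. -/
def HasNabla {k : ℕ} (κ : M → Spinor k) (N : Fin 2 → Fin 2 → Spinor k) : Prop :=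
  ∀ A, HasFrameDeriv e x (fun y => κ y A)
    (fun C C' => (N C C' + act (fun B D => spinConn e x C C' D B) (κ x)) A)

variable {e x}

theorem hasNabla_nabla {k : ℕ} {κ : M → Spinor k}
    (h : ∀ A, MDifferentiableAt 𝓘(ℝ, E4) 𝓘(ℝ, ℂ) (fun y => κ y A) x) :
    HasNabla e x κ (nabla e κ x) := fun A =>
  (h A).hasFrameDeriv.congr_deriv fun C C' => by simp [nabla, act]

/-- Fixing the first index leaves its connection term behind. -/
theorem HasNabla.slice {k : ℕ} {κ : M → Spinor (k + 1)} {N : Fin 2 → Fin 2 → Spinor (k + 1)}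
    (h : HasNabla e x κ N) (D : Fin 2) :
    HasNabla e x (fun y => slice D (κ y))
      (fun C C' => slice D (N C C') + ∑ B, spinConn e x C C' B D • slice B (κ x)) := fun A =>
  (h (cons D A)).congr_deriv fun C C' => by
    have := congrFun (slice_act (fun B D => spinConn e x C C' D B) (κ x) D) A
    simp only [slice_apply] at this
    simp only [Pi.add_apply, this, slice_apply]
    ring

variable (e x) in
/-- `∇_{CC'} τ_A{}^{A'}`. -/
def nablaLower (τ : M → Vec) (C C' A A' : Fin 2) : ℂ :=
  ∑ D, nablaVec e τ x C C' D A' * eps D A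

variable (e x) in
/-- The matrix `(∇_{CC'} τ_A{}^{A'}) (τ⁻¹)_{A'}{}^D` by which `∇_{CC'}` fails to commute with
Hermitian conjugation. -/
def hatDefect (τ : M → Vec) (C C' A D : Fin 2) : ℂ :=
  - ∑ F, eps F D * ∑ A', lowerFst (τ x) F A'
    * lower (fun B B' => nablaVec e τ x C C' B B') A A'

theorem det_of_normalised {τ : Vec} (h : ∑ A, ∑ A', lower τ A A' * τ A A' = 2) :
    τ 0 0 * τ 1 1 - τ 0 1 * τ 1 0 = 1 := by
  simp only [lower, Fin.sum_univ_two, eps] at h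
  simp at h
  linear_combination h / 2

/-- `hatDefect` solves `H · τ = ∇τ`: the matrix `τ_A{}^{A'}` is inverted by lowering its indices,
which uses that its determinant is one. -/
theorem hatDefect_mul {τ : M → Vec} (h : ∑ A, ∑ A', lower (τ x) A A' * τ x A A' = 2)
    (C C' A A' : Fin 2) :
    ∑ D, hatDefect e x τ C C' A D * lowerFst (τ x) D A' = nablaLower e x τ C C' A A' := by
  have hd := det_of_normalised h
  have h0 : ∑ D, hatDefect e x τ C C' 0 D * lowerFst (τ x) D A' = nablaLower e x τ C C' 0 A' := by
    fin_cases A' <;> simp [hatDefect, nablaLower, lower, lowerFst, eps] <;>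
      [linear_combination (-nablaVec e τ x C C' 1 0) * hd;
       linear_combination (-nablaVec e τ x C C' 1 1) * hd]
  have h1 : ∑ D, hatDefect e x τ C C' 1 D * lowerFst (τ x) D A' = nablaLower e x τ C C' 1 A' := by
    fin_cases A' <;> simp [hatDefect, nablaLower, lower, lowerFst, eps] <;>
      [linear_combination (nablaVec e τ x C C' 0 0) * hd;
       linear_combination (nablaVec e τ x C C' 0 1) * hd]
  fin_cases A
  exacts [h0, h1]

/-- `∇_{CC'} κ̂` is the Hermitian conjugate of `∇_{C'C} κ` plus the terms in which one factor `τ` of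
the conjugation is differentiated. -/
theorem HasNabla.hat {k : ℕ} {τ : M → Vec}
    (hτ : ∀ A A', MDifferentiableAt 𝓘(ℝ, E4) 𝓘(ℝ, ℂ) (fun y => τ y A A') x)
    (hn : ∑ A, ∑ A', lower (τ x) A A' * τ x A A' = 2)
    {κ : M → Spinor k} {N : Fin 2 → Fin 2 → Spinor k} (h : HasNabla e x κ N) :
    HasNabla e x (fun y => hat (τ y) (κ y)) (fun C C' =>
      SpaceSpinor.hat (τ x) (N C' C)
        + act (hatDefect e x τ C C') (SpaceSpinor.hat (τ x) (κ x))) := by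
  induction k with
  | zero =>
    intro A
    simp only [hat_zero]
    refine (h A).conj.congr_deriv fun C C' => ?_
    simp [act_zero, hat_zero]
  | succ k ih =>
    intro A'
    obtain ⟨D, A, rfl⟩ : ∃ D A, A' = cons D A := ⟨A' 0, tail A', (Fin.cons_self_tail A').symm⟩
    have hs : ∀ y, SpaceSpinor.hat (τ y) (κ y) (cons D A)
        = ∑ E, lowerFst (τ y) D E * SpaceSpinor.hat (τ y) (SpaceSpinor.slice E (κ y)) A := by
      intro y
      rw [← slice_apply D (SpaceSpinor.hat (τ y) (κ y)) A, slice_hat]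
      simp
    have hT : ∀ E, HasFrameDeriv e x (fun y => lowerFst (τ y) D E)
        (fun C C' => ∑ B, eps B D * frameDeriv e (fun y => τ y B E) x C C') := fun E =>
      ((HasFrameDeriv.sum Finset.univ fun B _ =>
        (hτ B E).hasFrameDeriv.const_mul (eps B D)).congr_deriv
          fun C C' => by simp only [Finset.sum_apply, Pi.smul_apply, smul_eq_mul]).congr
        (Filter.Eventually.of_forall fun y => by simp only [lowerFst, mul_comm])
    simp only [hs]
    refine (HasFrameDeriv.sum Finset.univ fun E _ =>
      (hT E).mul (ih (h.slice E) A)).congr_deriv fun C C' => ?_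
    -- The connection terms of the first index combine with `e_{CC'} τ_D{}^E` to `∇_{CC'} τ_D{}^E`.
    have key : ∀ E, ∑ F, lowerFst (τ x) D F * (starRingEnd ℂ) (spinConn e x C' C E F)
        + ∑ B, eps B D * frameDeriv e (fun y => τ y B E) x C C'
        = ∑ F, hatDefect e x τ C C' D F * lowerFst (τ x) F E
          + ∑ F, spinConn e x C C' F D * lowerFst (τ x) F E := by
      intro E
      rw [hatDefect_mul hn]
      have ht := spinConn_trace (e := e) (x := x) C C'
      fin_cases D <;>
        simp [nablaLower, nablaVec, lowerFst, spinConnBar, eps, ht] <;> ring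
    have key0 := key 0
    have key1 := key 1
    change _ = SpaceSpinor.slice D (SpaceSpinor.hat (τ x) (N C' C)
      + act (hatDefect e x τ C C') (SpaceSpinor.hat (τ x) (κ x))
      + act (fun B D => spinConn e x C C' D B) (SpaceSpinor.hat (τ x) (κ x))) A
    simp only [slice_add, slice_act, slice_hat, act_add, act_smul, hat_add, hat_smul,
      Finset.sum_apply, Pi.smul_apply, Pi.add_apply, smul_eq_mul, Fin.sum_univ_two]
    simp only [Fin.sum_univ_two] at key0 key1
    linear_combination SpaceSpinor.hat (τ x) (SpaceSpinor.slice 0 (κ x)) A * key0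
      + SpaceSpinor.hat (τ x) (SpaceSpinor.slice 1 (κ x)) A * key1

end Derivative

/-! ### The divergence of a current -/

/-- A bilinear pairing `b_{DB}(u, v)` with two free lower indices. -/
abbrev Pairing (k l : ℕ) := Fin 2 → Fin 2 → Spinor k →ₗ[ℂ] Spinor l →ₗ[ℂ] ℂ

/-- Equivariance of the pairing under `sl(2, ℂ)`. -/
def Pairing.IsEquivariant {k l : ℕ} (b : Pairing k l) : Prop :=
  ∀ M : Fin 2 → Fin 2 → ℂ, M 1 1 = - M 0 0 → ∀ u v D B,
    b D B (act M u) v + b D B u (act M v) = ∑ E, (M D E * b E B u v + M B E * b D E u v)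

/-- The matrix `τ_F{}^{Q'} (∇_{QQ'} τ_A{}^{A'}) (τ⁻¹)_{A'}{}^D`, expressed through `χ_{QFAC}`. -/
def chiMatrix (χ : Fin 2 → Fin 2 → Fin 2 → Fin 2 → ℂ) (Q F A D : Fin 2) : ℂ :=
  - (Real.sqrt 2 : ℂ) * ∑ C, eps C D * χ Q F A C

/-- `ε^{QB} ∇_{QQ'} (ϖ² τ^{DQ'})`, expressed through `χ`, `r = ϖ` and `d_{AB} = ∇_{AB} ϖ`. -/
def weightCoeff (χ : Fin 2 → Fin 2 → Fin 2 → Fin 2 → ℂ) (r : ℝ) (d : Fin 2 → Fin 2 → ℂ)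
    (D B : Fin 2) : ℂ :=
  ∑ Q, eps Q B * (2 * r * ∑ F, eps D F * d Q F
    + r ^ 2 * ((Real.sqrt 2 : ℂ) * ∑ A, eps D A * ∑ F, ∑ C, eps F C * χ Q F A C))

/-- The terms without derivatives of `u` and `v` in the divergence of
`ϖ² τ^{DQ'} b_D{}^Q(û, v)`, as a bilinear form in `û` and `v`. -/
def Pairing.zeroForm {k l : ℕ} (b : Pairing k l) (χ : Fin 2 → Fin 2 → Fin 2 → Fin 2 → ℂ) (r : ℝ)
    (d : Fin 2 → Fin 2 → ℂ) : Spinor k →ₗ[ℂ] Spinor l →ₗ[ℂ] ℂ :=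
  ∑ D, ∑ B, (weightCoeff χ r d D B • b D B
    + (r : ℂ) ^ 2 • ∑ Q, ∑ F, (eps Q B * eps D F) • (b D B ∘ₗ actL k (chiMatrix χ Q F)))

/-- The current `ϖ² τ^{DQ'} b_D{}^Q(u, v)`. -/
def Pairing.current {k l : ℕ} (b : Pairing k l) (τ : Vec) (r : ℝ) (u : Spinor k) (v : Spinor l) :
    Vec := fun Q Q' => (r : ℂ) ^ 2 * ∑ D, ∑ B, τ D Q' * eps Q B * b D B u v

/-- `ϖ² τ^{DQ'} ε^{QB} b_{DB}(u, v_{QQ'})`. -/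
def Pairing.principalRight {k l : ℕ} (b : Pairing k l) (τ : Vec) (r : ℝ) (u : Spinor k)
    (v : Fin 2 → Fin 2 → Spinor l) : ℂ :=
  (r : ℂ) ^ 2 * ∑ Q, ∑ Q', ∑ D, ∑ B, τ D Q' * eps Q B * b D B u (v Q Q')

/-- `ϖ² τ^{DQ'} ε^{QB} b_{DB}(û_{Q'Q}, v)`. -/
def Pairing.principalLeft {k l : ℕ} (b : Pairing k l) (τ : Vec) (r : ℝ)
    (u : Fin 2 → Fin 2 → Spinor k) (v : Spinor l) : ℂ :=
  (r : ℂ) ^ 2 * ∑ Q, ∑ Q', ∑ D, ∑ B, τ D Q' * eps Q B * b D B (hat τ (u Q' Q)) v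

theorem lowerFst_raise (τ : Vec) (D Q' : Fin 2) : τ D Q' = ∑ F, eps D F * lowerFst τ F Q' := by
  fin_cases D <;> simp [lowerFst, eps]

section Divergence

variable {M : Type*} [TopologicalSpace M] [ChartedSpace E4 M] [IsManifold 𝓘(ℝ, E4) ∞ M]
variable {g : LorentzMetric M} {U : Set M} {e : SpinFrame g U} {x : M}

/-- For an equivariant pairing, the product rule holds for covariant derivatives: the connection
terms that remain are those of the two free indices. -/
theorem Pairing.IsEquivariant.hasFrameDeriv {k l : ℕ} {b : Pairing k l} (hb : b.IsEquivariant)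
    {u : M → Spinor k} {v : M → Spinor l} {Nu : Fin 2 → Fin 2 → Spinor k}
    {Nv : Fin 2 → Fin 2 → Spinor l} (hu : HasNabla e x u Nu) (hv : HasNabla e x v Nv)
    (D B : Fin 2) :
    HasFrameDeriv e x (fun y => b D B (u y) (v y)) (fun C C' =>
      b D B (Nu C C') (v x) + b D B (u x) (Nv C C')
        + ∑ E, (spinConn e x C C' E D * b E B (u x) (v x)
          + spinConn e x C C' E B * b D E (u x) (v x))) :=
  (HasFrameDeriv.bilin (b D B) hu hv).congr_deriv fun C C' => by
    have h := hb (fun B D => spinConn e x C C' D B) (spinConn_trace C C') (u x) (v x) D B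
    rw [← h]
    change b D B (Nu C C' + act _ (u x)) (v x) + b D B (u x) (Nv C C' + act _ (v x)) = _
    simp only [map_add, LinearMap.add_apply]
    ring

/-- The divergence of `τ` in terms of `χ`: as `τ_A{}^{A'}` has determinant one, the trace
`ε^{FC} χ_{QFAC}` removes both factors `τ` from `χ`. -/
theorem sum_nablaVec_eq_chi {τ : M → Vec} (hn : ∑ A, ∑ A', lower (τ x) A A' * τ x A A' = 2)
    (Q D : Fin 2) :
    ∑ Q', nablaVec e τ x Q Q' D Q' = (Real.sqrt 2 : ℂ) * ∑ A, eps D A * ∑ F, ∑ C, eps F C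
      * weingarten e τ x Q F A C := by
  have hd := det_of_normalised hn
  have h2 : (Real.sqrt 2 : ℂ) ≠ 0 := by
    exact_mod_cast (Real.sqrt_pos.2 (by norm_num : (0 : ℝ) < 2)).ne'
  have hc : ∀ z : ℂ, (Real.sqrt 2 : ℂ) * (z / (Real.sqrt 2 : ℂ)) = z := fun z => by field_simp
  simp only [Finset.mul_sum, weingarten]
  simp only [mul_left_comm (Real.sqrt 2 : ℂ), hc]
  fin_cases D <;> simp [lower, lowerFst, eps]
  · linear_combination (-(nablaVec e τ x Q 0 0 0 + nablaVec e τ x Q 1 0 1)) * hd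
  · linear_combination (-(nablaVec e τ x Q 0 1 0 + nablaVec e τ x Q 1 1 1)) * hd

theorem sum_hatDefect {τ : M → Vec} (Q F A D : Fin 2) :
    ∑ Q', lowerFst (τ x) F Q' * hatDefect e x τ Q Q' A D
      = chiMatrix (weingarten e τ x) Q F A D := by
  have h2 : (Real.sqrt 2 : ℂ) ≠ 0 := by
    exact_mod_cast (Real.sqrt_pos.2 (by norm_num : (0 : ℝ) < 2)).ne'
  simp only [hatDefect, chiMatrix, weingarten, Fin.sum_univ_two]
  field_simp
  ring

/-- The divergence of the current of an equivariant pairing. -/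
theorem Pairing.IsEquivariant.div_current {k l : ℕ} {b : Pairing k l} (hb : b.IsEquivariant)
    {τ : M → Vec} (hτ : ∀ A A', MDifferentiableAt 𝓘(ℝ, E4) 𝓘(ℝ, ℂ) (fun y => τ y A A') x)
    (hn : ∑ A, ∑ A', lower (τ x) A A' * τ x A A' = 2) {ϖ : M → ℝ}
    (hϖ : MDifferentiableAt 𝓘(ℝ, E4) 𝓘(ℝ, ℂ) (fun y => (ϖ y : ℂ)) x)
    {κ : M → Spinor k} {μ : M → Spinor l}
    (hκ : ∀ A, MDifferentiableAt 𝓘(ℝ, E4) 𝓘(ℝ, ℂ) (fun y => κ y A) x)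
    (hμ : ∀ A, MDifferentiableAt 𝓘(ℝ, E4) 𝓘(ℝ, ℂ) (fun y => μ y A) x)
    {V : M → Vec}
    (hV : ∀ᶠ y in nhds x, V y = b.current (τ y) (ϖ y) (hat (τ y) (κ y)) (μ y)) :
    div e V x = b.principalLeft (τ x) (ϖ x) (nabla e κ x) (μ x)
      + b.principalRight (τ x) (ϖ x) (hat (τ x) (κ x)) (nabla e μ x)
      + b.zeroForm (weingarten e τ x) (ϖ x) (spaceGrad e τ ϖ x) (hat (τ x) (κ x)) (μ x) := by
  have hVd : ∀ Q Q', HasFrameDeriv e x (fun y => V y Q Q') _ := fun Q Q' =>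
    (((hϖ.hasFrameDeriv.mul hϖ.hasFrameDeriv).mul
      (HasFrameDeriv.sum Finset.univ fun D _ => HasFrameDeriv.sum Finset.univ fun B _ =>
        ((hτ D Q').hasFrameDeriv.mul (HasFrameDeriv.const (eps Q B))).mul
          (hb.hasFrameDeriv ((hasNabla_nabla hκ).hat hτ hn) (hasNabla_nabla hμ) D B)))).congr
      (hV.mono fun y hy => by
        change V y Q Q' = _
        rw [hy, Pairing.current, sq])
  set h := hat (τ x) (κ x)
  -- The Leibniz rule for a single component.
  have hC : ∀ C C' Q Q', nablaVec e V x C C' Q Q'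
      = ∑ D, ∑ B, eps Q B * ((2 * ϖ x * frameDeriv e (fun y => (ϖ y : ℂ)) x C C' * τ x D Q'
          + (ϖ x : ℂ) ^ 2 * nablaVec e τ x C C' D Q') * b D B h (μ x)
        + (ϖ x : ℂ) ^ 2 * τ x D Q' * (b D B (hat (τ x) (nabla e κ x C' C)) (μ x)
          + b D B (act (hatDefect e x τ C C') h) (μ x) + b D B h (nabla e μ x C C'))) := by
    intro C C' Q Q'
    have hVx : V x = _ := hV.self_of_nhds
    have ht := spinConn_trace (e := e) (x := x) C C'
    rw [nablaVec, (hVd Q Q').2, hVx]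
    simp only [Pairing.current, nablaVec, Pi.add_apply, Pi.smul_apply, Pi.zero_apply, smul_eq_mul,
      Fin.sum_univ_two, map_add, LinearMap.add_apply, ht]
    fin_cases Q <;> simp [eps, ht] <;> ring
  -- Writing `τ^{DQ'} = ε^{DF} τ_F{}^{Q'}` turns the defect of Hermitian conjugation into `χ`.
  have hH : ∀ Q D B, ∑ Q', τ x D Q' * b D B (act (hatDefect e x τ Q Q') h) (μ x)
      = ∑ F, eps D F * b D B (act (chiMatrix (weingarten e τ x) Q F) h) (μ x) := by
    intro Q D B
    have : ∀ F, chiMatrix (weingarten e τ x) Q F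
        = ∑ Q', lowerFst (τ x) F Q' • hatDefect e x τ Q Q' := by
      intro F
      funext A D
      rw [← sum_hatDefect]
      simp
    simp only [this, lowerFst_raise (τ x) D, Fin.sum_univ_two, act_add_left, act_smul_left,
      map_add, map_smul, LinearMap.add_apply, LinearMap.smul_apply, smul_eq_mul]
    ring
  have hw : ∀ D B, ∑ Q, ∑ Q', eps Q B * (2 * ϖ x * frameDeriv e (fun y => (ϖ y : ℂ)) x Q Q'
        * τ x D Q' + (ϖ x : ℂ) ^ 2 * nablaVec e τ x Q Q' D Q')
      = weightCoeff (weingarten e τ x) (ϖ x) (spaceGrad e τ ϖ x) D B := by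
    intro D B
    simp only [weightCoeff, ← sum_nablaVec_eq_chi hn, spaceGrad]
    refine Finset.sum_congr rfl fun Q _ => ?_
    simp only [lowerFst_raise (τ x) D, Fin.sum_univ_two]
    ring
  simp only [Pairing.zeroForm, ← hw, LinearMap.sum_apply, LinearMap.add_apply,
    LinearMap.smul_apply, LinearMap.comp_apply, actL_apply, smul_eq_mul]
  have hH' : ∀ D B, ∑ Q, ∑ F, eps Q B * eps D F
        * b D B (act (chiMatrix (weingarten e τ x) Q F) h) (μ x)
      = ∑ Q, eps Q B * ∑ Q', τ x D Q' * b D B (act (hatDefect e x τ Q Q') h) (μ x) := by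
    intro D B
    simp only [hH, Finset.mul_sum, mul_assoc]
  simp only [hH']
  simp only [div, hC, Pairing.principalLeft, Pairing.principalRight, Fin.sum_univ_two]
  ring

end Divergence

/-! ### The pairings of the four currents -/

/-- `b_{DB}(u, v) = u_D{}^{A_1 ⋯ A_k} v_{B A_1 ⋯ A_k}`. -/
def slicePairing (k : ℕ) : Pairing (k + 1) (k + 1) := fun D B =>
  (contrL k).compl₁₂ (sliceL k D) (sliceL k B)

/-- The pairing of the current `J`. -/
def pairingJ (n : ℕ) : Pairing (n + 2) (n + 2) := fun D B => -slicePairing (n + 1) D B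

/-- The pairing of the current `K`. -/
def pairingK (n : ℕ) : Pairing (n + 2) n := fun D B =>
  -(contrL n).compl₁₂ (sliceL n B ∘ₗ sliceL (n + 1) D) LinearMap.id

/-- The pairing of the current `L`. -/
def pairingL (n : ℕ) : Pairing n (n + 2) := fun D B =>
  (contrL n).compl₁₂ LinearMap.id (sliceL n D ∘ₗ sliceL (n + 1) B)

/-- The pairing of the current `I`, on symmetric spinors. Among the `k + 1` places into which the
symmetrisation `ψ̂^{(A_1 ⋯ A_k} ζ^{P)P'}` puts the index `P`, one is on `ζ` and contributes
`ε_{DB} u^{A_1 ⋯ A_k} v_{A_1 ⋯ A_k}`, and the `k` others contribute equally. -/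
def pairingI : (n : ℕ) → Pairing n n
  | 0 => fun D B => eps D B • contrL 0
  | k + 1 => fun D B =>
      (1 / (k + 2) : ℂ) • (eps D B • contrL (k + 1) + (k + 1 : ℂ) • slicePairing k B D)

@[simp] theorem slicePairing_apply {k : ℕ} (D B : Fin 2) (u v : Spinor (k + 1)) :
    slicePairing k D B u v = contr (slice D u) (slice B v) := rfl

@[simp] theorem pairingJ_apply {n : ℕ} (D B : Fin 2) (u v : Spinor (n + 2)) :
    pairingJ n D B u v = -contr (slice D u) (slice B v) := rfl

@[simp] theorem pairingK_apply {n : ℕ} (D B : Fin 2) (u : Spinor (n + 2)) (v : Spinor n) :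
    pairingK n D B u v = -contr (slice B (slice D u)) v := rfl

@[simp] theorem pairingL_apply {n : ℕ} (D B : Fin 2) (u : Spinor n) (v : Spinor (n + 2)) :
    pairingL n D B u v = contr u (slice D (slice B v)) := rfl

@[simp] theorem pairingI_zero_apply (D B : Fin 2) (u v : Spinor 0) :
    pairingI 0 D B u v = eps D B * contr u v := rfl

@[simp] theorem pairingI_succ_apply {k : ℕ} (D B : Fin 2) (u v : Spinor (k + 1)) :
    pairingI (k + 1) D B u v = (1 / (k + 2)) * (eps D B * contr u v
      + (k + 1) * contr (slice B u) (slice D v)) := rfl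

theorem slicePairing_isEquivariant (k : ℕ) : (slicePairing k).IsEquivariant := by
  intro M hM u v D B
  have h := contr_act M (by rw [hM]; ring) (slice D u) (slice B v)
  simp only [slicePairing_apply, slice_act, ← contrL_apply, Fin.sum_univ_two, map_add, map_smul,
    LinearMap.add_apply, LinearMap.smul_apply, smul_eq_mul] at h ⊢
  linear_combination h

theorem pairingJ_isEquivariant (n : ℕ) : (pairingJ n).IsEquivariant := by
  intro M hM u v D B
  have h := slicePairing_isEquivariant (n + 1) M hM u v D B
  simp only [slicePairing_apply, pairingJ_apply, Fin.sum_univ_two] at h ⊢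
  linear_combination -h

theorem pairingK_isEquivariant (n : ℕ) : (pairingK n).IsEquivariant := by
  intro M hM u v D B
  have h := contr_act M (by rw [hM]; ring) (slice B (slice D u)) v
  simp only [pairingK_apply, slice_act, slice_add, slice_smul, ← contrL_apply, Fin.sum_univ_two,
    map_add, map_smul, LinearMap.add_apply, LinearMap.smul_apply, smul_eq_mul] at h ⊢
  linear_combination -h

theorem pairingL_isEquivariant (n : ℕ) : (pairingL n).IsEquivariant := by
  intro M hM u v D B
  have h := contr_act M (by rw [hM]; ring) u (slice D (slice B v))
  simp only [pairingL_apply, slice_act, slice_add, slice_smul, ← contrL_apply, Fin.sum_univ_two,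
    map_add, map_smul, smul_eq_mul] at h ⊢
  linear_combination h

theorem pairingI_isEquivariant (n : ℕ) : (pairingI n).IsEquivariant := by
  intro M hM u v D B
  have h := contr_act M (by rw [hM]; ring) u v
  have hε : ∀ z : ℂ, ∑ E, (M D E * (eps E B * z) + M B E * (eps D E * z)) = 0 := by
    intro z
    fin_cases D <;> fin_cases B <;> simp [eps, hM]
  cases n with
  | zero =>
    simp only [pairingI_zero_apply, hε]
    linear_combination eps D B * h
  | succ k =>
    have h' := slicePairing_isEquivariant k M hM u v B D
    have hε' := hε (contr u v)
    simp only [slicePairing_apply, pairingI_succ_apply, Fin.sum_univ_two] at h' hε' ⊢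
    linear_combination (1 / (k + 2) : ℂ) * (eps D B * h + (k + 1) * h' - hε')

/-- Complex conjugation exchanges the two halves of the principal parts of `b` and `b'`. -/
def Pairing.IsConjugate {k l : ℕ} (b : Pairing k l) (b' : Pairing l k) : Prop :=
  ∀ τ : Vec, (∀ A A', (starRingEnd ℂ) (τ A A') = τ A' A) →
    τ 0 0 * τ 1 1 - τ 0 1 * τ 1 0 = 1 → ∀ (r : ℝ) (κ : Spinor k) (μ : Fin 2 → Fin 2 → Spinor l),
    (starRingEnd ℂ) (b.principalRight τ r (hat τ κ) μ) = b'.principalLeft τ r μ κ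

theorem conj_eps (A B : Fin 2) : (starRingEnd ℂ) (eps A B) = eps A B := by
  fin_cases A <;> fin_cases B <;> simp [eps]

theorem eps_zero_zero : eps 0 0 = 0 := by simp [eps]

theorem eps_zero_one : eps 0 1 = 1 := by simp [eps]

theorem eps_one_zero : eps 1 0 = -1 := by simp [eps]

theorem eps_one_one : eps 1 1 = 0 := by simp [eps]

theorem pairingJ_isConjugate (n : ℕ) : (pairingJ n).IsConjugate (pairingJ n) := by
  intro τ hτ hd r κ μ
  simp only [Pairing.principalRight, Pairing.principalLeft, pairingJ_apply, slice_hat,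
    ← contrL_apply, Fin.sum_univ_two, map_add, map_mul, map_neg, map_pow, map_smul,
    LinearMap.add_apply, LinearMap.smul_apply, smul_eq_mul, conj_eps, hτ, lowerFst,
    Complex.conj_ofReal]
  simp only [contrL_apply, conj_contr_hat τ hτ]
  simp only [eps_zero_zero, eps_zero_one, eps_one_zero, eps_one_one]
  ring

theorem pairingK_isConjugate (n : ℕ) : (pairingK n).IsConjugate (pairingL n) := by
  intro τ hτ hd r κ μ
  simp only [Pairing.principalRight, Pairing.principalLeft, pairingK_apply, pairingL_apply,
    slice_hat, slice_add, slice_smul,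
    ← contrL_apply, Fin.sum_univ_two, map_add, map_mul, map_neg, map_pow, map_smul,
    LinearMap.add_apply, LinearMap.smul_apply, smul_eq_mul, conj_eps, hτ, lowerFst,
    Complex.conj_ofReal]
  simp only [contrL_apply, conj_contr_hat τ hτ]
  simp only [eps_zero_zero, eps_zero_one, eps_one_zero, eps_one_one]
  linear_combination (r : ℂ) ^ 2 * (τ 0 0 * contr (hat τ (μ 0 0)) (slice 0 (slice 1 κ))
    - τ 0 0 * contr (hat τ (μ 0 1)) (slice 0 (slice 0 κ))
    + τ 1 1 * contr (hat τ (μ 1 0)) (slice 1 (slice 1 κ))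
    - τ 1 1 * contr (hat τ (μ 1 1)) (slice 1 (slice 0 κ))
    + τ 1 0 * contr (hat τ (μ 0 0)) (slice 1 (slice 1 κ))
    - τ 1 0 * contr (hat τ (μ 0 1)) (slice 1 (slice 0 κ))
    + τ 0 1 * contr (hat τ (μ 1 0)) (slice 0 (slice 1 κ))
    - τ 0 1 * contr (hat τ (μ 1 1)) (slice 0 (slice 0 κ))) * hd

theorem pairingL_isConjugate (n : ℕ) : (pairingL n).IsConjugate (pairingK n) := by
  intro τ hτ hd r κ μ
  simp only [Pairing.principalRight, Pairing.principalLeft, pairingK_apply, pairingL_apply,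
    slice_hat, slice_add, slice_smul,
    ← contrL_apply, Fin.sum_univ_two, map_add, map_mul, map_pow, map_smul,
    LinearMap.add_apply, LinearMap.smul_apply, smul_eq_mul, conj_eps, hτ, lowerFst,
    Complex.conj_ofReal]
  simp only [contrL_apply, conj_contr_hat τ hτ]
  simp only [eps_zero_zero, eps_zero_one, eps_one_zero, eps_one_one]
  linear_combination -(r : ℂ) ^ 2 * (τ 0 0 * contr (hat τ (slice 0 (slice 1 (μ 0 0)))) κ
    - τ 0 0 * contr (hat τ (slice 0 (slice 0 (μ 1 0)))) κ
    + τ 0 1 * contr (hat τ (slice 1 (slice 1 (μ 0 0)))) κ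
    - τ 0 1 * contr (hat τ (slice 1 (slice 0 (μ 1 0)))) κ
    + τ 1 0 * contr (hat τ (slice 0 (slice 1 (μ 0 1)))) κ
    - τ 1 0 * contr (hat τ (slice 0 (slice 0 (μ 1 1)))) κ
    + τ 1 1 * contr (hat τ (slice 1 (slice 1 (μ 0 1)))) κ
    - τ 1 1 * contr (hat τ (slice 1 (slice 0 (μ 1 1)))) κ) * hd

theorem pairingI_isConjugate (n : ℕ) : (pairingI n).IsConjugate (pairingI n) := by
  intro τ hτ hd r κ μ
  cases n with
  | zero =>
    simp only [Pairing.principalRight, Pairing.principalLeft, pairingI_zero_apply,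
      Fin.sum_univ_two, map_add, map_mul, map_pow, conj_eps, hτ, Complex.conj_ofReal,
      conj_contr_hat τ hτ]
    simp only [eps_zero_zero, eps_zero_one, eps_one_zero, eps_one_one]
    ring
  | succ k =>
    simp only [Pairing.principalRight, Pairing.principalLeft, pairingI_succ_apply, slice_hat,
      ← contrL_apply, Fin.sum_univ_two, map_add, map_mul, map_pow, map_smul, map_div₀, map_one,
      LinearMap.add_apply, LinearMap.smul_apply, smul_eq_mul, conj_eps, hτ, lowerFst,
      Complex.conj_ofReal, Complex.conj_natCast, Complex.conj_ofNat]
    simp only [contrL_apply, conj_contr_hat τ hτ]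
    simp only [eps_zero_zero, eps_zero_one, eps_one_zero, eps_one_one]
    ring

/-! ### Contractions with a symmetrised index -/

/-- Exchanging the free index `P` with any of the `k + 1` summed indices gives the same sum. -/
theorem sum_update_of_symm {k : ℕ} (α : Fin 2 → Spinor (k + 1)) (hα : ∀ D, IsSymm (α D))
    {β : Spinor (k + 1)} (hβ : IsSymm β) (P : Fin 2) :
    ∑ A : Idx (k + 1), ∑ j, α (A j) (Function.update A j P) * β A
      = (k + 1) * ∑ D, ∑ A : Idx k, α D (cons P A) * β (cons D A) := by
  have hj : ∀ j, ∑ A : Idx (k + 1), α (A j) (Function.update A j P) * β A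
      = ∑ D, ∑ A : Idx k, α D (cons P A) * β (cons D A) := by
    intro j
    rw [← sum_comp_perm (Equiv.swap 0 j), sum_idx_succ]
    refine Finset.sum_congr rfl fun D _ => Finset.sum_congr rfl fun A _ => ?_
    rw [hβ]
    have hu : Function.update ((cons D A : Idx (k + 1)) ∘ Equiv.swap 0 j) j P
        = (cons P A : Idx (k + 1)) ∘ Equiv.swap 0 j := by
      rw [← Function.update_comp_eq_of_injective _ (Equiv.swap 0 j).injective,
        Equiv.swap_apply_right, Fin.update_cons_zero]
    rw [hu, hα]
    simp
  rw [Finset.sum_comm, Finset.sum_congr rfl fun j _ => hj j]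
  simp [mul_add]

theorem sum_eps_eps (z : Fin 2 → ℂ) (P : Fin 2) :
    ∑ D, ∑ B, z D * eps P B * eps D B = z P := by
  fin_cases P <;> simp [eps]

/-- The contraction in the current `I`, for `t^D = τ^{DP'}`. -/
theorem sum_symz_raise {n : ℕ} {h ψ : Spinor n} (hh : IsSymm h) (hψ : IsSymm ψ) (t : Fin 2 → ℂ)
    (P : Fin 2) :
    ∑ A : Idx n, symz (fun B : Idx (n + 1) => t (B 0) * raise h (tail B)) (cons P A) * ψ A
      = ∑ D, ∑ B, t D * eps P B * pairingI n D B h ψ := by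
  have hs : ∀ D, IsSymm (slice D fun B : Idx (n + 1) => t (B 0) * raise h (tail B)) := by
    intro D s A
    simp [slice, hh.raise s A]
  simp only [symz_of_slice_symm _ hs]
  cases n with
  | zero =>
    simp only [pairingI_zero_apply, ← mul_assoc, ← Finset.sum_mul, sum_eps_eps]
    simp [contr, mul_assoc]
  | succ k =>
    have h1 := sum_update_of_symm (fun D => t D • raise h) (fun D s A => by
      simp [hh.raise s A]) hψ P
    have h2 := sum_eps_eps (fun D => t D * contr h ψ) P
    have h3 : ∑ A, t P * raise h A * ψ A = t P * contr h ψ := by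
      simp [contr, Finset.mul_sum, mul_assoc]
    have h4 : ∑ D, ∑ A : Idx k, t D * raise h (cons P A) * ψ (cons D A)
        = ∑ D, ∑ B, t D * eps P B * contr (slice B h) (slice D ψ) := by
      refine Finset.sum_congr rfl fun D _ => ?_
      simp only [raise_cons, contr, Fin.sum_univ_two, Finset.mul_sum, ← Finset.sum_add_distrib]
      exact Finset.sum_congr rfl fun A _ => by rw [slice_apply D ψ A]; ring
    simp only [Pi.smul_apply, smul_eq_mul] at h1
    simp only [Fin.cons_zero, Fin.tail_cons, div_mul_eq_mul_div, ← Finset.sum_div, add_mul,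
      Finset.sum_mul, Finset.sum_add_distrib, pairingI_succ_apply]
    rw [h1, h3, h4]
    have hk : (k + 2 : ℂ) ≠ 0 := by exact_mod_cast (Nat.succ_ne_zero (k + 1))
    simp only [Fin.sum_univ_two] at h2 ⊢
    push_cast
    rw [show (k + 1 + 1 : ℂ) = k + 2 by ring]
    field_simp
    linear_combination -h2

/-- The symmetrised derivative in `𝓕` contracts to the pairing of `I`. -/
theorem contr_symz_tail {n : ℕ} {h : Spinor n} (hh : IsSymm h) {N : Fin 2 → Spinor n}
    (hN : ∀ D, IsSymm (N D)) (P : Fin 2) :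
    contr h (fun A => symz (fun B : Idx (n + 1) => N (B 0) (tail B)) (cons P A))
      = ∑ Q, ∑ B, eps Q B * pairingI n P B h (N Q) := by
  have hs : ∀ D, IsSymm (slice D fun B : Idx (n + 1) => N (B 0) (tail B)) := by
    intro D s A
    simp [slice, hN D s A]
  simp only [symz_of_slice_symm _ hs]
  have h2 := sum_eps_eps (fun D => contr h (N D)) P
  cases n with
  | zero =>
    simp only [pairingI_zero_apply]
    have h3 : contr h (fun A => N P A) = contr h (N P) := rfl
    simp only [Fin.sum_univ_two] at h2 ⊢
    simp
    linear_combination h3 - h2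
  | succ k =>
    have h1 := sum_update_of_symm N hN hh.raise P
    have h4 : ∑ D, ∑ A : Idx k, N D (cons P A) * raise h (cons D A)
        = ∑ D, ∑ B, eps D B * contr (slice B h) (slice P (N D)) := by
      refine Finset.sum_congr rfl fun D _ => ?_
      simp only [raise_cons, contr, Fin.sum_univ_two, Finset.mul_sum, ← Finset.sum_add_distrib]
      exact Finset.sum_congr rfl fun A _ => by rw [slice_apply P (N D) A]; ring
    have h5 : contr h (fun A => (N P A + ∑ j, N (A j) (Function.update A j P)) / (k + 1 + 1))
        = (contr h (N P) + ∑ A, ∑ j, N (A j) (Function.update A j P) * raise h A) / (k + 2) := by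
      simp only [contr, ← Finset.sum_add_distrib, Finset.sum_div]
      refine Finset.sum_congr rfl fun A _ => ?_
      rw [← Finset.sum_mul]
      ring
    have hk : (k + 2 : ℂ) ≠ 0 := by exact_mod_cast (Nat.succ_ne_zero (k + 1))
    simp only [Fin.cons_zero, Fin.tail_cons, pairingI_succ_apply]
    push_cast
    rw [h5, h1, h4]
    simp only [Fin.sum_univ_two] at h2 ⊢
    field_simp
    linear_combination -h2

/-! ### The currents and the two forms in terms of the pairings -/

section Fields

variable {M : Type*} {n : ℕ} (τ : M → Vec) (ϖ : M → ℝ) (φ : M → Spinor (n + 2))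
  (ψ : M → Spinor n) (x : M)

theorem currentJ_eq :
    currentJ τ ϖ φ x = (pairingJ n).current (τ x) (ϖ x) (hat (τ x) (φ x)) (φ x) := by
  funext Q Q'
  simp only [currentJ, Pairing.current, pairingJ_apply, contr, sum_idx_succ (k := n + 1),
    raise_cons, Fin.cons_zero, Fin.tail_cons, zeta, lowerFst, Fin.sum_univ_two,
    eps_zero_zero, eps_zero_one, eps_one_zero, eps_one_one, slice_apply _ (φ x),
    Finset.mul_sum, ← Finset.sum_neg_distrib, ← Finset.sum_add_distrib]
  exact Finset.sum_congr rfl fun A _ => by ring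

theorem currentK_eq :
    currentK τ ϖ φ ψ x = (pairingK n).current (τ x) (ϖ x) (hat (τ x) (φ x)) (ψ x) := by
  funext Q Q'
  simp only [currentK, Pairing.current, pairingK_apply, contr,
    raise_cons, zeta, lowerFst, Fin.sum_univ_two,
    eps_zero_zero, eps_zero_one, eps_one_zero, eps_one_one,
    Finset.mul_sum, ← Finset.sum_neg_distrib, ← Finset.sum_add_distrib]
  exact Finset.sum_congr rfl fun A _ => by ring

theorem currentL_eq :
    currentL τ ϖ φ ψ x = (pairingL n).current (τ x) (ϖ x) (hat (τ x) (ψ x)) (φ x) := by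
  funext P P'
  simp only [currentL, Pairing.current, pairingL_apply, contr, zeta, Fin.sum_univ_two,
    slice_apply, Finset.mul_sum, ← Finset.sum_add_distrib]
  exact Finset.sum_congr rfl fun A _ => by ring

theorem currentI_eq (hψ : IsSymm (ψ x)) :
    currentI τ ϖ ψ x = (pairingI n).current (τ x) (ϖ x) (hat (τ x) (ψ x)) (ψ x) := by
  funext P P'
  simp only [currentI, Pairing.current]
  rw [sum_symz_raise (hψ.hat _) hψ fun D => zeta τ ϖ x D P']
  simp only [zeta, Finset.mul_sum, mul_assoc]

end Fields

theorem IsSymmField.mdifferentiableAt {M : Type*} [TopologicalSpace M] [ChartedSpace E4 M]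
    {U : Set M} {x : M} {k : ℕ} {κ : M → Spinor k} (hκ : IsSymmField U κ) (hU : IsOpen U)
    (hx : x ∈ U) (A : Idx k) :
    MDifferentiableAt 𝓘(ℝ, E4) 𝓘(ℝ, ℂ) (fun y => κ y A) x :=
  ((hκ.contMDiffOn A).contMDiffAt (hU.mem_nhds hx)).mdifferentiableAt one_ne_zero

section Forms

variable {M : Type*} [TopologicalSpace M] [ChartedSpace E4 M] [IsManifold 𝓘(ℝ, E4) ∞ M]
variable {g : LorentzMetric M} {U : Set M} {e : SpinFrame g U} {x : M}

theorem IsSymmField.isSymm_nabla {k : ℕ} {κ : M → Spinor k} (hκ : IsSymmField U κ)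
    (hU : IsOpen U) (hx : x ∈ U) (C C' : Fin 2) : IsSymm (nabla e κ x C C') := by
  intro s A
  have h1 : frameDeriv e (fun y => κ y (A ∘ s)) x C C' = frameDeriv e (fun y => κ y A) x C C' := by
    have : (fun y => κ y (A ∘ s)) =ᶠ[nhds x] fun y => κ y A :=
      Filter.eventually_of_mem (hU.mem_nhds hx) fun y hy => hκ.symm y hy s A
    rw [frameDeriv_congr this]
  have h2 := (hκ.symm x hx).act (fun B D => spinConn e x C C' D B) s A
  change frameDeriv e (fun y => κ y (A ∘ s)) x C C'
      - act (fun B D => spinConn e x C C' D B) (κ x) (A ∘ s)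
    = frameDeriv e (fun y => κ y A) x C C' - act (fun B D => spinConn e x C C' D B) (κ x) A
  rw [h1, h2]

variable {n : ℕ} {τ : M → Vec} {ϖ : M → ℝ} {c : ℝ} {φ : M → Spinor (n + 2)} {ψ : M → Spinor n}

theorem contr_calE {h : Spinor (n + 2)} (hh : IsSymm h) :
    contr h (calE e τ ϖ c φ ψ x)
      = - (pairingJ n).principalRight (τ x) (ϖ x) h (nabla e φ x)
        + c * (pairingK n).principalRight (τ x) (ϖ x) h (nabla e ψ x) := by
  rw [calE, hh.contr_symz]
  have hs : ∀ D, slice D (fun A : Idx (n + 2) =>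
      ∑ A', ∑ Q, lowerFst (zeta τ ϖ x) (A 0) A' * nablaUp e φ x Q A' (cons Q (tail A)))
      = ∑ A', ∑ Q, ∑ C, (lowerFst (zeta τ ϖ x) D A' * eps Q C) • slice Q (nabla e φ x C A') := by
    intro D
    funext A
    simp only [slice_apply, nablaUp, Fin.cons_zero, Fin.tail_cons, Finset.sum_apply,
      Pi.smul_apply, smul_eq_mul, Finset.mul_sum, mul_assoc]
  have hs' : ∀ D B, slice B (slice D (fun A : Idx (n + 2) =>
      c * ∑ A', lowerFst (zeta τ ϖ x) (A 0) A' * nabla e ψ x (A 1) A' (tail (tail A))))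
      = ∑ A', (c * lowerFst (zeta τ ϖ x) D A') • nabla e ψ x B A' := by
    intro D B
    funext A
    have h1 : (cons D (cons B A) : Idx (n + 2)) 1 = B := rfl
    simp only [slice_apply, Fin.cons_zero, Fin.tail_cons, Finset.sum_apply, h1,
      Pi.smul_apply, smul_eq_mul, Finset.mul_sum, mul_assoc]
  have hadd : ∀ f f' : Spinor (n + 2), contr h (fun A => f A + f' A) = contr h f + contr h f' :=
    fun f f' => (contrL _ h).map_add f f'
  rw [hadd]
  congr 1
  · rw [contr_succ]
    simp only [hs, ← contrL_apply, map_sum, map_smul, smul_eq_mul]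
    simp only [contrL_apply, Pairing.principalRight, pairingJ_apply, zeta, lowerFst,
      Fin.sum_univ_two, eps_zero_zero, eps_zero_one, eps_one_zero, eps_one_one]
    ring
  · rw [contr_succ]
    simp only [contr_succ (k := n), hs', ← contrL_apply, map_sum, map_smul, smul_eq_mul]
    simp only [contrL_apply, Pairing.principalRight, pairingK_apply, zeta, lowerFst,
      Fin.sum_univ_two, eps_zero_zero, eps_zero_one, eps_one_zero, eps_one_one]
    ring

theorem contr_calF {h : Spinor n} (hh : IsSymm h)
    (hψ : ∀ C C', IsSymm (nabla e ψ x C C')) :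
    contr h (calF e τ ϖ c φ ψ x)
      = - (pairingL n).principalRight (τ x) (ϖ x) h (nabla e φ x)
        + c * (pairingI n).principalRight (τ x) (ϖ x) h (nabla e ψ x) := by
  have hF : calF e τ ϖ c φ ψ x
      = (∑ Q, ∑ P, ∑ A', ∑ C, (zeta τ ϖ x Q A' * eps P C) • slice Q (slice P (nabla e φ x C A')))
        + ∑ P, ∑ A', (c * zeta τ ϖ x P A') • (fun A =>
          symz (fun B : Idx (n + 1) => nabla e ψ x (B 0) A' (tail B)) (cons P A)) := by
    funext A
    simp only [calF, nablaUp, slice_apply, Pi.add_apply, Finset.sum_apply,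
      Pi.smul_apply, smul_eq_mul, Finset.mul_sum, mul_assoc]
  rw [hF]
  simp only [← contrL_apply, map_add, map_sum, map_smul, smul_eq_mul]
  have hI := fun P A' => contr_symz_tail hh (fun D => hψ D A') P
  simp only [contrL_apply, hI]
  simp only [Pairing.principalRight, pairingL_apply, zeta,
      Fin.sum_univ_two, eps_zero_zero, eps_zero_one, eps_one_zero, eps_one_one]
  ring

end Forms

end SpaceSpinor

end

theorem mainTheorem1 (n : ℕ) :
    ∃ (W : SpaceSpinor.CoeffRule (n + 2) (n + 2)) (X : SpaceSpinor.CoeffRule (n + 2) n)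
      (Y : SpaceSpinor.CoeffRule n (n + 2)) (Z : SpaceSpinor.CoeffRule n n),
    SpaceSpinor.IsSymmRule W ∧ SpaceSpinor.IsSymmRule X ∧
    SpaceSpinor.IsSymmRule Y ∧ SpaceSpinor.IsSymmRule Z ∧
    ∀ (M : Type u) [TopologicalSpace M] [ChartedSpace SpaceSpinor.E4 M]
      [IsManifold 𝓘(ℝ, SpaceSpinor.E4) ∞ M]
      (g : SpaceSpinor.LorentzMetric M) (U : Set M) (_ : IsOpen U)
      (e : SpaceSpinor.SpinFrame g U)
      (τ : M → SpaceSpinor.Vec) (_ : SpaceSpinor.IsTimelikeUnit U τ)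
      (ϖ : M → ℝ) (_ : ContMDiffOn 𝓘(ℝ, SpaceSpinor.E4) 𝓘(ℝ, ℝ) 1 ϖ U)
      (c : ℝ)
      (φ : M → SpaceSpinor.Spinor (n + 2)) (_ : SpaceSpinor.IsSymmField U φ)
      (ψ : M → SpaceSpinor.Spinor n) (_ : SpaceSpinor.IsSymmField U ψ)
      (x : M) (_ : x ∈ U),
      SpaceSpinor.formE e τ ϖ c φ ψ x - c * SpaceSpinor.formF e τ ϖ c φ ψ x
        = - SpaceSpinor.div e (SpaceSpinor.currentJ τ ϖ φ) x
          - c ^ 2 * SpaceSpinor.div e (SpaceSpinor.currentI τ ϖ ψ) x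
          + c * SpaceSpinor.div e (SpaceSpinor.currentK τ ϖ φ ψ) x
          + c * SpaceSpinor.div e (SpaceSpinor.currentL τ ϖ φ ψ) x
          + SpaceSpinor.quad (φ x)
              (W (SpaceSpinor.weingarten e τ x) (ϖ x) (SpaceSpinor.spaceGrad e τ ϖ x))
              (SpaceSpinor.hat (τ x) (φ x))
          + c * SpaceSpinor.quad (φ x)
              (X (SpaceSpinor.weingarten e τ x) (ϖ x) (SpaceSpinor.spaceGrad e τ ϖ x))
              (SpaceSpinor.hat (τ x) (ψ x))
          + c * SpaceSpinor.quad (ψ x)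
              (Y (SpaceSpinor.weingarten e τ x) (ϖ x) (SpaceSpinor.spaceGrad e τ ϖ x))
              (SpaceSpinor.hat (τ x) (φ x))
          + c ^ 2 * SpaceSpinor.quad (ψ x)
              (Z (SpaceSpinor.weingarten e τ x) (ϖ x) (SpaceSpinor.spaceGrad e τ ϖ x))
              (SpaceSpinor.hat (τ x) (ψ x)) := by
  obtain ⟨W, hWs, hW⟩ := SpaceSpinor.exists_symm_rule (SpaceSpinor.pairingJ n).zeroForm
  obtain ⟨X, hXs, hX⟩ := SpaceSpinor.exists_symm_rule
    fun χ r d => -(SpaceSpinor.pairingL n).zeroForm χ r d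
  obtain ⟨Y, hYs, hY⟩ := SpaceSpinor.exists_symm_rule
    fun χ r d => -(SpaceSpinor.pairingK n).zeroForm χ r d
  obtain ⟨Z, hZs, hZ⟩ := SpaceSpinor.exists_symm_rule (SpaceSpinor.pairingI n).zeroForm
  refine ⟨W, X, Y, Z, hWs, hXs, hYs, hZs, ?_⟩
  intro M _ _ _ g U hU e τ hτ ϖ hϖ c φ hφ ψ hψ x hx
  have hφx := hφ.symm x hx
  have hψx := hψ.symm x hx
  have hherm := hτ.hermitian x hx
  have hn := hτ.normalised x hx
  have hdet := SpaceSpinor.det_of_normalised hn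
  have hτd : ∀ A A', MDifferentiableAt 𝓘(ℝ, SpaceSpinor.E4) 𝓘(ℝ, ℂ) (fun y => τ y A A') x :=
    fun A A' => ((hτ.contMDiffOn A A').contMDiffAt (hU.mem_nhds hx)).mdifferentiableAt one_ne_zero
  have hϖd : MDifferentiableAt 𝓘(ℝ, SpaceSpinor.E4) 𝓘(ℝ, ℂ) (fun y => (ϖ y : ℂ)) x :=
    Complex.ofRealCLM.mdifferentiableAt.comp x
      ((hϖ.contMDiffAt (hU.mem_nhds hx)).mdifferentiableAt one_ne_zero)
  have hφd := hφ.mdifferentiableAt hU hx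
  have hψd := hψ.mdifferentiableAt hU hx
  have hJ := (SpaceSpinor.pairingJ_isEquivariant n).div_current (e := e) hτd hn hϖd hφd hφd
    (Filter.Eventually.of_forall fun y => SpaceSpinor.currentJ_eq τ ϖ φ y)
  have hK := (SpaceSpinor.pairingK_isEquivariant n).div_current (e := e) hτd hn hϖd hφd hψd
    (Filter.Eventually.of_forall fun y => SpaceSpinor.currentK_eq τ ϖ φ ψ y)
  have hL := (SpaceSpinor.pairingL_isEquivariant n).div_current (e := e) hτd hn hϖd hψd hφd
    (Filter.Eventually.of_forall fun y => SpaceSpinor.currentL_eq τ ϖ φ ψ y)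
  have hI := (SpaceSpinor.pairingI_isEquivariant n).div_current (e := e) hτd hn hϖd hψd hψd
    (Filter.eventually_of_mem (hU.mem_nhds hx) fun y hy =>
      SpaceSpinor.currentI_eq τ ϖ ψ y (hψ.symm y hy))
  -- The signs of `contr_hat_right` cancel the factors `(-1) ^ m` in the definitions of `𝐄`, `𝐅`.
  have hs : ∀ z : ℂ, (-1) ^ n * ((-1) ^ n * z) = z := fun z => by
    rw [← mul_assoc, ← mul_pow]
    simp
  have hs2 : (-1 : ℂ) ^ (n + 2) = (-1) ^ n := by rw [pow_add]; simp
  rw [hW _ _ _ _ _ hφx (hφx.hat _), hX _ _ _ _ _ hφx (hψx.hat _), hY _ _ _ _ _ hψx (hφx.hat _),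
    hZ _ _ _ _ _ hψx (hψx.hat _), hJ, hK, hL, hI, SpaceSpinor.formE, SpaceSpinor.formF,
    SpaceSpinor.contr_hat_right _ hherm, SpaceSpinor.contr_hat_right _ hherm,
    hs2, hs, hs,
    SpaceSpinor.contr_calE (hφx.hat _),
    SpaceSpinor.contr_calF (hψx.hat _) (hψ.isSymm_nabla hU hx)]
  simp only [map_add, map_neg, map_mul, Complex.conj_ofReal, LinearMap.neg_apply,
    SpaceSpinor.pairingJ_isConjugate n _ hherm hdet,
    SpaceSpinor.pairingK_isConjugate n _ hherm hdet,
    SpaceSpinor.pairingL_isConjugate n _ hherm hdet,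
    SpaceSpinor.pairingI_isConjugate n _ hherm hdet]
  ring
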